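/- **Setting.** Fix a typed first-order language with the basic types $\mathit{int}$ and $\mathit{bool}$, the symbols of linear integer arithmetic (LIA) and booleans, equality, algebraic data types (ADTs) given by constructors (each ADT has a ground term), and predicate symbols $\mathit{Pred}$. A *constraint* is a quantifier-free formula of LIA $\cup$ Bool; an *atom* is $p(t_1,\dots,t_m)$ with $p\in\mathit{Pred}$. A *clause* is $H\leftarrow c,B$ with $c$ a constraint, $B$ a finite conjunction of atoms, and $H$ an atom (*definite clause*) or $\mathit{false}$ (*goal*); its variables are universally quantified. In every atom of every clause below, each term of basic type is a variable. (Clauses derived by R5 below may also contain equations $Y=Z$ between ADT variables next to the constraint.) A *variant* of a clause is obtained by renaming variables and reordering the body atoms; the clauses below may freely be replaced by variants when a rule is applied. Integers, booleans and LIA symbols have their usual interpretation $\mathbb D$ and ADT values are the trees freely generated by the constructors. $\mathit{Definite}(P)$ is the set of definite clauses of $P$, and for a set $P$ of definite clauses $M(P)$ is its least model, i.e. the set of ground atoms true in all models of $P$. For a conjunction $F$ of $m\ge 1$ atoms write $F(X,Y)$ if $X,Y$ are disjoint tuples of distinct variables with $\mathit{vars}(F)=X\cup Y$. It is *functional* from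 $X$ to $Y$ w.r.t. $P$ if $M(P)\models\forall X,Y,Z.\;F(X,Y)\wedge F(X,Z)\to Y=Z$, and *total* if $M(P)\models\forall X\,\exists Y.\;F(X,Y)$; if both hold it is written $F(X;Y)$. Let $\ell:\mathit{Pred}\to\mathbb N$ be a level mapping; the level of an atom is that of its predicate. Conditions on $\ell(H)$ are void when $H=\mathit{false}$. A *transformation sequence* $P_0\Rightarrow P_1\Rightarrow\cdots\Rightarrow P_n$ is a sequence of sets of clauses such that $\ell(H)\ge\ell(A)$ for every body atom $A$ of every definite clause $H\leftarrow c,B$ of $P_0$, and each $P_{i+1}$ is obtained from $P_i$ by one of the following rules, where $\mathit{Defs}_i$ is the set of clauses introduced by R1 in the steps before $P_i$. * **R1 (Definition).** $P_{i+1}=P_i\cup\{D\}$ with $D:\ \mathit{newp}(X_1,\dots,X_k)\leftarrow c,A_1,\dots,A_m$, where $\mathit{newp}$ does not occur in $P_0,\dots,P_i$, $c$ is a constraint, the predicates of the $A_j$ occur in $P_0$, the $X_j$ are variables in $\mathit{vars}(\{c,A_1,\dots,A_m\})$, and $\ell(\mathit{newp})=\max_j\ell(A_j)$ ($0$ if $m=0$).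 * **R2 (Unfolding).** For $C:\ H\leftarrow c,G_L,A,G_R$ in $P_i$, where the predicate of the atom $A$ occurs in $P_0$: $P_{i+1}=(P_i\setminus\{C\})\cup\{(H\leftarrow c,c_j,G_L,B_j,G_R)\vartheta_j\mid j\}$, where $K_j\leftarrow c_j,B_j$ ranges over the clauses of $P_0$ (renamed apart from $C$) such that $A$ and $K_j$ have a most general unifier $\vartheta_j$ and $(c,c_j)\vartheta_j$ is satisfiable. * **R3 (Folding).** For $C:\ H\leftarrow c,G_L,Q,G_R$ in $P_i$ and a variant $K\leftarrow d,B$ of some $D\in\mathit{Defs}_i$ with $\ell(H)\ge\ell(K)$ and a substitution $\vartheta$ with $Q=B\vartheta$ and $\mathbb D\models\forall(c\to d\vartheta)$: replace $C$ by $H\leftarrow c,G_L,K\vartheta,G_R$. * **R4 (Clause deletion).** Delete a clause whose constraint is unsatisfiable. * **R5 (Functionality).** For $C:\ H\leftarrow c,G_L,F(X,Y),F(X,Z),G_R$ in $P_i$, where $Z$ is a tuple of distinct variables not occurring in $X$ and $F(X,Y)$ is functional from $X$ to $Y$ w.r.t. $\mathit{Definite}(P_0)\cup\mathit{Defs}_i$: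 replace $C$ by $H\leftarrow c,Y=Z,G_L,F(X,Y),G_R$. * **R6 (Totality).** For $C:\ H\leftarrow c,G_L,F(X,Y),G_R$ in $P_i$ with $Y\cap\mathit{vars}(H\leftarrow c,G_L,G_R)=\emptyset$ and $F(X,Y)$ total from $X$ to $Y$ w.r.t. $\mathit{Definite}(P_0)\cup\mathit{Defs}_i$: replace $C$ by $H\leftarrow c,G_L,G_R$. * **R7 (Differential replacement).** For $C:\ H\leftarrow c,G_L,F(X;Y),G_R$ in $P_i$ and a variant $\mathit{diff}(Z)\leftarrow d,F(X;Y),R(V;W)$ of some $D\in\mathit{Defs}_i$, where $F(X;Y)$ and $R(V;W)$ are total and functional w.r.t. $\mathit{Definite}(P_0)\cup\mathit{Defs}_i$, $W\cap\mathit{vars}(C)=\emptyset$, $\mathbb D\models\forall(c\to d)$ and $\ell(H)>\ell(\mathit{diff}(Z))$: replace $C$ by $H\leftarrow c,G_L,R(V;W),\mathit{diff}(Z),G_R$. **Condition (U).** For $i=1,\dots,n-1$, if $P_i\Rightarrow P_{i+1}$ by folding with a definition $D:\ H\leftarrow c,B$ in $\mathit{Defs}_i$, then for some $j\in\{1,\dots,n-1\}\setminus\{i\}$,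 $P_j\Rightarrow P_{j+1}$ by unfolding $D$ with respect to an atom $A$ such that $\ell(H)=\ell(A)$. **Proposition (Preservation of Functionality).** Let $P_0\Rightarrow P_1\Rightarrow\cdots\Rightarrow P_n$ be a transformation sequence using R1–R7 that satisfies Condition (U). For $i=0,\dots,n$, if an atom $A(X,Y)$ is functional from $X$ to $Y$ with respect to $\mathit{Definite}(P_n)$ and the predicate symbol of $A(X,Y)$ occurs in $\mathit{Definite}(P_0)\cup\mathit{Defs}_i$, then $A(X,Y)$ is functional from $X$ to $Y$ with respect to $\mathit{Definite}(P_0)\cup\mathit{Defs}_i$. -/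

import Mathlib

/-!
Constrained Horn clauses over linear integer arithmetic, booleans and algebraic data types;
least models; the transformation rules R1-R7; transformation sequences; Condition (U);
functionality of atoms.
-/

universe u

namespace CHC

/-- The types of the language: the basic types `int` and `bool`, and the algebraic data types. -/
inductive Srt (T : Type u) : Type u
  | int : Srt T
  | bool : Srt T
  | adt : T → Srt T

/-- A typed language: algebraic data types with their typed constructors (possibly constants), and
typed predicate symbols. The symbols of linear integer arithmetic and of the booleans are built into
terms and formulas below. -/
structure Signature where
  /-- names of the algebraic data types -/
  Adt : Type u
  /-- constructors of the algebraic data types -/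
  Ctor : Type u
  ctorArity : Ctor → ℕ
  ctorArg : (c : Ctor) → Fin (ctorArity c) → Srt Adt
  ctorRes : Ctor → Adt
  /-- predicate symbols -/
  Pred : Type u
  arity : Pred → ℕ
  predArg : (p : Pred) → Fin (arity p) → Srt Adt

variable {S : Signature.{u}}

/-! ### Terms, formulas, atoms, clauses -/

/-- Typed terms. There are countably many variables `var s 0, var s 1, …` of each type `s`. -/
inductive Tm (S : Signature.{u}) : Srt S.Adt → Type u
  | var (s : Srt S.Adt) (k : ℕ) : Tm S s
  | intLit (z : ℤ) : Tm S .int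
  | plus (t t' : Tm S .int) : Tm S .int
  | scale (z : ℤ) (t : Tm S .int) : Tm S .int
  | boolLit (b : Bool) : Tm S .bool
  | app (c : S.Ctor) (args : (k : Fin (S.ctorArity c)) → Tm S (S.ctorArg c k)) :
      Tm S (.adt (S.ctorRes c))

/-- Quantifier-free formulas without predicate symbols. Equality is available at every type. -/
inductive Fml (S : Signature.{u}) : Type u
  | tru : Fml S
  | fls : Fml S
  | le (t t' : Tm S .int) : Fml S
  | holds (t : Tm S .bool) : Fml S
  | eq (s : Srt S.Adt) (t t' : Tm S s) : Fml S
  | neg (f : Fml S) : Fml S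
  | conj (f g : Fml S) : Fml S
  | disj (f g : Fml S) : Fml S

/-- The formula belongs to the language of linear integer arithmetic and booleans, i.e. it is a
constraint: there is no equality between terms of an algebraic data type. -/
def Fml.IsConstraint : Fml S → Prop
  | .eq (.adt _) _ _ => False
  | .neg f => f.IsConstraint
  | .conj f g => f.IsConstraint ∧ g.IsConstraint
  | .disj f g => f.IsConstraint ∧ g.IsConstraint
  | _ => True

/-- Atoms `p(t₁, …, tₘ)`. -/
structure Atom (S : Signature.{u}) where
  pred : S.Pred
  args : (k : Fin (S.arity pred)) → Tm S (S.predArg pred k)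

/-- A clause `head ← constr, body`; the head `none` stands for `false`. -/
structure Clause (S : Signature.{u}) where
  head : Option (Atom S)
  constr : Fml S
  body : List (Atom S)

/-- Every subterm of basic type is a variable. -/
def Tm.Flat : {s : Srt S.Adt} → Tm S s → Prop
  | _, .var _ _ => True
  | _, .app _ args => ∀ k, (args k).Flat
  | _, .intLit _ => False
  | _, .plus _ _ => False
  | _, .scale _ _ => False
  | _, .boolLit _ => False

/-- Each term of basic type occurring in the atom is a variable. -/
def Atom.Flat (A : Atom S) : Prop := ∀ k, (A.args k).Flat

/-- All atoms of the clause (head and body) are flat. -/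
def Clause.Flat (C : Clause S) : Prop :=
  (∀ H, C.head = some H → H.Flat) ∧ ∀ A ∈ C.body, A.Flat

/-! ### Variables -/

/-- Variables, as pairs of a type and an index. -/
abbrev Vr (S : Signature.{u}) : Type u := (_ : Srt S.Adt) × ℕ

/-- The set of variables of a term. -/
def Tm.vars : {s : Srt S.Adt} → Tm S s → Set (Vr S)
  | _, .var s k => {⟨s, k⟩}
  | _, .app _ args => ⋃ k, (args k).vars
  | _, .intLit _ => ∅
  | _, .plus t t' => t.vars ∪ t'.vars
  | _, .scale _ t => t.vars
  | _, .boolLit _ => ∅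

/-- The set of variables of a formula. -/
def Fml.vars : Fml S → Set (Vr S)
  | .tru => ∅
  | .fls => ∅
  | .le t t' => t.vars ∪ t'.vars
  | .holds t => t.vars
  | .eq _ t t' => t.vars ∪ t'.vars
  | .neg f => f.vars
  | .conj f g => f.vars ∪ g.vars
  | .disj f g => f.vars ∪ g.vars

/-- The set of variables of an atom. -/
def Atom.vars (A : Atom S) : Set (Vr S) := ⋃ k, (A.args k).vars

/-- The set of variables of a conjunction of atoms. -/
def conjVars (F : List (Atom S)) : Set (Vr S) := {x | ∃ A ∈ F, x ∈ A.vars}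

/-- The set of variables of a clause. -/
def Clause.vars (C : Clause S) : Set (Vr S) :=
  {x | ∃ H, C.head = some H ∧ x ∈ H.vars} ∪ C.constr.vars ∪ conjVars C.body

/-! ### Substitutions, variants, unifiers -/

/-- Typed substitutions. -/
abbrev Sbst (S : Signature.{u}) : Type u := (s : Srt S.Adt) → ℕ → Tm S s

/-- Application of a substitution to a term. -/
def Tm.subst (θ : Sbst S) : {s : Srt S.Adt} → Tm S s → Tm S s
  | _, .var s k => θ s k
  | _, .app c args => .app c fun k => (args k).subst θ
  | _, .intLit z => .intLit z
  | _, .plus t t' => .plus (t.subst θ) (t'.subst θ)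
  | _, .scale z t => .scale z (t.subst θ)
  | _, .boolLit b => .boolLit b

/-- Application of a substitution to a formula. -/
def Fml.subst (θ : Sbst S) : Fml S → Fml S
  | .tru => .tru
  | .fls => .fls
  | .le t t' => .le (t.subst θ) (t'.subst θ)
  | .holds t => .holds (t.subst θ)
  | .eq s t t' => .eq s (t.subst θ) (t'.subst θ)
  | .neg f => .neg (f.subst θ)
  | .conj f g => .conj (f.subst θ) (g.subst θ)
  | .disj f g => .disj (f.subst θ) (g.subst θ)

/-- Application of a substitution to an atom. -/
def Atom.subst (θ : Sbst S) (A : Atom S) : Atom S := ⟨A.pred, fun k => (A.args k).subst θ⟩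

/-- Application of a substitution to a clause. -/
def Clause.subst (θ : Sbst S) (C : Clause S) : Clause S :=
  ⟨C.head.map (Atom.subst θ), C.constr.subst θ, C.body.map (Atom.subst θ)⟩

/-- The substitution given by a type-preserving map of variables. -/
def rnm (ρ : Srt S.Adt → ℕ → ℕ) : Sbst S := fun s k => .var s (ρ s k)

/-- `D` is a variant of `C`: it is obtained from `C` by renaming variables and rearranging the
order of the atoms in the body. -/
def Variant (C D : Clause S) : Prop :=
  ∃ ρ : Srt S.Adt → Equiv.Perm ℕ,
    D.head = C.head.map (Atom.subst (rnm fun s => ρ s)) ∧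
    D.constr = C.constr.subst (rnm fun s => ρ s) ∧
    D.body.Perm (C.body.map (Atom.subst (rnm fun s => ρ s)))

/-- The substitution unifies the two atoms. -/
def IsUnifier (θ : Sbst S) (A B : Atom S) : Prop := A.subst θ = B.subst θ

/-- The substitution is a most general unifier of the two atoms. -/
def IsMGU (θ : Sbst S) (A B : Atom S) : Prop :=
  IsUnifier θ A B ∧
    ∀ η : Sbst S, IsUnifier η A B → ∃ δ : Sbst S, ∀ s k, η s k = (θ s k).subst δ

/-! ### Semantics -/

/-- The values of each type: integers, booleans, and trees freely generated by the constructors. -/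
inductive Val (S : Signature.{u}) : Srt S.Adt → Type u
  | int (z : ℤ) : Val S .int
  | bool (b : Bool) : Val S .bool
  | app (c : S.Ctor) (args : (k : Fin (S.ctorArity c)) → Val S (S.ctorArg c k)) :
      Val S (.adt (S.ctorRes c))

/-- The integer denoted by a value of type `int`. -/
def Val.toInt : Val S .int → ℤ
  | .int z => z

/-- The boolean denoted by a value of type `bool`. -/
def Val.toBool : Val S .bool → Bool
  | .bool b => b

/-- Typed valuations of the variables. -/
abbrev Valuation (S : Signature.{u}) : Type u := (s : Srt S.Adt) → ℕ → Val S s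

/-- The value of a term. -/
def Tm.eval (v : Valuation S) : {s : Srt S.Adt} → Tm S s → Val S s
  | _, .var s k => v s k
  | _, .app c args => .app c fun k => (args k).eval v
  | _, .intLit z => .int z
  | _, .plus t t' => .int ((t.eval v).toInt + (t'.eval v).toInt)
  | _, .scale z t => .int (z * (t.eval v).toInt)
  | _, .boolLit b => .bool b

/-- Truth of a formula under a valuation. -/
def Fml.Sat (v : Valuation S) : Fml S → Prop
  | .tru => True
  | .fls => False
  | .le t t' => (t.eval v).toInt ≤ (t'.eval v).toInt
  | .holds t => (t.eval v).toBool = true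
  | .eq _ t t' => t.eval v = t'.eval v
  | .neg f => ¬ f.Sat v
  | .conj f g => f.Sat v ∧ g.Sat v
  | .disj f g => f.Sat v ∨ g.Sat v

/-- The formula is satisfiable. -/
def Fml.Satisfiable (f : Fml S) : Prop := ∃ v : Valuation S, f.Sat v

/-- The universal closure of `f → g` is true. -/
def Fml.Entails (f g : Fml S) : Prop := ∀ v : Valuation S, f.Sat v → g.Sat v

/-- Ground atoms `p(d₁, …, dₘ)`. -/
structure GAtom (S : Signature.{u}) where
  pred : S.Pred
  args : (k : Fin (S.arity pred)) → Val S (S.predArg pred k)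

/-- The ground instance of an atom under a valuation. -/
def Atom.eval (v : Valuation S) (A : Atom S) : GAtom S := ⟨A.pred, fun k => (A.args k).eval v⟩

/-- An interpretation, given by the set of its true ground atoms, makes the (universally
quantified) clause true. -/
def Clause.TrueIn (I : Set (GAtom S)) (C : Clause S) : Prop :=
  ∀ v : Valuation S, C.constr.Sat v → (∀ A ∈ C.body, A.eval v ∈ I) →
    ∃ H, C.head = some H ∧ H.eval v ∈ I

/-- The interpretation is a model of the set of clauses. -/
def IsModel (I : Set (GAtom S)) (P : Set (Clause S)) : Prop := ∀ C ∈ P, C.TrueIn I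

/-- The ground atoms that are true in all models of `P`. For a set `P` of definite clauses this is
the least model `M(P)`. -/
def leastModel (P : Set (Clause S)) : Set (GAtom S) := {a | ∀ I, IsModel I P → a ∈ I}

/-- The definite clauses of `P`: those whose head is an atom. -/
def Definite (P : Set (Clause S)) : Set (Clause S) := {C ∈ P | ∃ H, C.head = some H}

/-- For a set of definite clauses, `leastModel` is indeed a model. -/
theorem leastModel_isModel (P : Set (Clause S)) : IsModel (leastModel (Definite P)) (Definite P) := by
  intro C hC v hc hb
  obtain ⟨H, hH⟩ := hC.2
  refine ⟨H, hH, fun I hI => ?_⟩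
  obtain ⟨H', hH', hv⟩ := hI C hC v hc fun A hA => hb A hA I hI
  rw [hH] at hH'
  cases hH'
  exact hv

/-- All atoms of the conjunction are true in `I` under `v`. -/
def ConjTrue (I : Set (GAtom S)) (F : List (Atom S)) (v : Valuation S) : Prop :=
  ∀ A ∈ F, A.eval v ∈ I

/-- The two valuations agree on a set of variables. -/
def AgreeOn (X : Set (Vr S)) (v w : Valuation S) : Prop := ∀ x ∈ X, v x.1 x.2 = w x.1 x.2

/-- The notation `F(X,Y)`: a nonempty conjunction whose set of variables is the disjoint union
of `X` and `Y`. -/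
def HasVars (F : List (Atom S)) (X Y : Set (Vr S)) : Prop :=
  F ≠ [] ∧ conjVars F = X ∪ Y ∧ Disjoint X Y

/-- `F(X,Y)` is functional from `X` to `Y` with respect to `P`:
`M(P) ⊨ ∀ X, Y, Z. F(X,Y) ∧ F(X,Z) → Y = Z`. The two valuations give the values of `(X,Y)` and of
`(X,Z)`. -/
def Functional (P : Set (Clause S)) (F : List (Atom S)) (X Y : Set (Vr S)) : Prop :=
  HasVars F X Y ∧ ∀ v w : Valuation S, AgreeOn X v w →
    ConjTrue (leastModel P) F v → ConjTrue (leastModel P) F w → AgreeOn Y v w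

/-- `F(X,Y)` is total from `X` to `Y` with respect to `P`: `M(P) ⊨ ∀ X ∃ Y. F(X,Y)`. -/
def Total (P : Set (Clause S)) (F : List (Atom S)) (X Y : Set (Vr S)) : Prop :=
  HasVars F X Y ∧ ∀ v : Valuation S, ∃ w, AgreeOn X v w ∧ ConjTrue (leastModel P) F w

/-! ### Predicates and levels -/

/-- The predicate symbol occurs in the clause. -/
def Clause.HasPred (C : Clause S) (p : S.Pred) : Prop :=
  (∃ H, C.head = some H ∧ H.pred = p) ∨ ∃ A ∈ C.body, A.pred = p

/-- The predicate symbol occurs in the set of clauses. -/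
def OccursIn (p : S.Pred) (P : Set (Clause S)) : Prop := ∃ C ∈ P, C.HasPred p

/-- The clause is stratified with respect to the level mapping (goals impose no condition). -/
def Clause.Stratified (ℓ : S.Pred → ℕ) (C : Clause S) : Prop :=
  ∀ H, C.head = some H → ∀ A ∈ C.body, ℓ A.pred ≤ ℓ H.pred

/-- The maximum level of the atoms of a conjunction (`0` if it is empty). -/
def maxLevel (ℓ : S.Pred → ℕ) (F : List (Atom S)) : ℕ :=
  (F.map fun A => ℓ A.pred).foldr max 0

/-! ### The transformation rules -/

/-- The rule applied in a step, with the data of the step that later steps refer to: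
the clause of the current set that is replaced, the introduced or used definition, and the atom
with respect to which a clause is unfolded. -/
inductive RuleApp (S : Signature.{u}) : Type u
  | definition (D : Clause S)
  | unfolding (C : Clause S) (A : Atom S)
  | folding (C D : Clause S)
  | deletion (C : Clause S)
  | functionality (C : Clause S)
  | totality (C : Clause S)
  | replacement (C D : Clause S)

/-- (R1) `Ps` are the sets constructed so far, `Defs` the definitions so far. -/
def DefinitionRule (ℓ : S.Pred → ℕ) (P : ℕ → Set (Clause S)) (i : ℕ) (D : Clause S)
    (Pnext : Set (Clause S)) : Prop :=
  ∃ (newp : S.Pred) (xs : (k : Fin (S.arity newp)) → ℕ),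
    D.head = some ⟨newp, fun k => .var _ (xs k)⟩ ∧
    (∀ j ≤ i, ¬ OccursIn newp (P j)) ∧
    D.constr.IsConstraint ∧
    (∀ A ∈ D.body, OccursIn A.pred (P 0)) ∧
    (∀ k, (⟨S.predArg newp k, xs k⟩ : Vr S) ∈ D.constr.vars ∪ conjVars D.body) ∧
    ℓ newp = maxLevel ℓ D.body ∧
    Pnext = P i ∪ {D}

/-- The clause obtained from `H ← c, Gl, A, Gr` by replacing `A` by the body of a clause `K`
and applying `θ`. -/
def unfoldedClause (H : Option (Atom S)) (c : Fml S) (Gl Gr : List (Atom S)) (K : Clause S)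
    (θ : Sbst S) : Clause S :=
  Clause.subst θ ⟨H, .conj c K.constr, Gl ++ K.body ++ Gr⟩

/-- (R2) The clause `C` is unfolded with respect to `A`, whose predicate occurs in `P₀`, using all
clauses of `P₀` (renamed apart) whose head unifies with `A` and yields a satisfiable constraint. -/
def UnfoldingRule (P₀ Pi : Set (Clause S)) (C : Clause S) (A : Atom S)
    (Pnext : Set (Clause S)) : Prop :=
  ∃ (H : Option (Atom S)) (c : Fml S) (Gl Gr : List (Atom S))
    (apart : Clause S → Clause S) (θ : Clause S → Sbst S),
    C ∈ Pi ∧ Variant C ⟨H, c, Gl ++ [A] ++ Gr⟩ ∧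
    OccursIn A.pred P₀ ∧
    (∀ K ∈ P₀, Variant K (apart K) ∧
      Disjoint (apart K).vars (Clause.vars ⟨H, c, Gl ++ [A] ++ Gr⟩)) ∧
    (∀ K ∈ P₀, ∀ B, (apart K).head = some B → (∃ η, IsUnifier η A B) → IsMGU (θ K) A B) ∧
    Pnext = (Pi \ {C}) ∪
      {E | ∃ K ∈ P₀, ∃ B, (apart K).head = some B ∧ IsMGU (θ K) A B ∧
        (Fml.subst (θ K) (.conj c (apart K).constr)).Satisfiable ∧
        E = unfoldedClause H c Gl Gr (apart K) (θ K)}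

/-- (R3) The clause `C` is folded using (a variant of) the definition `D`. -/
def FoldingRule (ℓ : S.Pred → ℕ) (Pi Defsi : Set (Clause S)) (C D : Clause S)
    (Pnext : Set (Clause S)) : Prop :=
  ∃ (H : Option (Atom S)) (c : Fml S) (Gl Q Gr : List (Atom S))
    (K : Atom S) (d : Fml S) (B : List (Atom S)) (θ : Sbst S),
    C ∈ Pi ∧ Variant C ⟨H, c, Gl ++ Q ++ Gr⟩ ∧
    D ∈ Defsi ∧ Variant D ⟨some K, d, B⟩ ∧
    (∀ H', H = some H' → ℓ K.pred ≤ ℓ H'.pred) ∧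
    Q = B.map (Atom.subst θ) ∧
    c.Entails (d.subst θ) ∧
    Pnext = (Pi \ {C}) ∪ {⟨H, c, Gl ++ [K.subst θ] ++ Gr⟩}

/-- (R4) A clause with an unsatisfiable constraint is deleted. -/
def DeletionRule (Pi : Set (Clause S)) (C : Clause S) (Pnext : Set (Clause S)) : Prop :=
  C ∈ Pi ∧ ¬ C.constr.Satisfiable ∧ Pnext = Pi \ {C}

/-- The formula `Y = Z`, where `Y` is a tuple of variables and `Z` is its image under a
type-preserving map of variables. -/
def tupleEq (Y : List (Vr S)) (ζ : Srt S.Adt → ℕ → ℕ) : Fml S :=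
  (Y.map fun y => Fml.eq y.1 (.var y.1 y.2) (.var y.1 (ζ y.1 y.2))).foldr .conj .tru

/-- (R5) `F(X,Y), F(X,Z)` is replaced by `Y = Z, F(X,Y)`, where `F(X,Y)` is functional. The map `ζ`
sends the variables of the tuple `Y` to the distinct variables of the tuple `Z`, which do not occur
in `X`, and fixes all variables outside `Y`. -/
def FunctionalityRule (Q Pi : Set (Clause S)) (C : Clause S) (Pnext : Set (Clause S)) : Prop :=
  ∃ (H : Option (Atom S)) (c : Fml S) (Gl F Gr : List (Atom S))
    (X : Set (Vr S)) (Y : List (Vr S)) (ζ : Srt S.Adt → ℕ → ℕ),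
    C ∈ Pi ∧
    Variant C ⟨H, c, Gl ++ (F ++ F.map (Atom.subst (rnm ζ))) ++ Gr⟩ ∧
    Y.Nodup ∧
    (∀ s k, (⟨s, k⟩ : Vr S) ∉ Y → ζ s k = k) ∧
    (∀ s k k', (⟨s, k⟩ : Vr S) ∈ Y → (⟨s, k'⟩ : Vr S) ∈ Y → ζ s k = ζ s k' → k = k') ∧
    (∀ s k, (⟨s, k⟩ : Vr S) ∈ Y → (⟨s, ζ s k⟩ : Vr S) ∉ X) ∧
    Functional Q F X {y | y ∈ Y} ∧
    Pnext = (Pi \ {C}) ∪ {⟨H, .conj c (tupleEq Y ζ), Gl ++ F ++ Gr⟩}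

/-- (R6) A total conjunction `F(X,Y)` is removed, if `Y` does not occur in the rest of the
clause. -/
def TotalityRule (Q Pi : Set (Clause S)) (C : Clause S) (Pnext : Set (Clause S)) : Prop :=
  ∃ (H : Option (Atom S)) (c : Fml S) (Gl F Gr : List (Atom S)) (X Y : Set (Vr S)),
    C ∈ Pi ∧ Variant C ⟨H, c, Gl ++ F ++ Gr⟩ ∧
    Disjoint Y (Clause.vars ⟨H, c, Gl ++ Gr⟩) ∧
    Total Q F X Y ∧
    Pnext = (Pi \ {C}) ∪ {⟨H, c, Gl ++ Gr⟩}

/-- (R7) A total, functional conjunction `F(X;Y)` is replaced by `R(V;W), diff(Z)`, using (a variant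
of) the definition `D` of `diff`. -/
def ReplacementRule (ℓ : S.Pred → ℕ) (Q Pi Defsi : Set (Clause S)) (C D : Clause S)
    (Pnext : Set (Clause S)) : Prop :=
  ∃ (H : Option (Atom S)) (c : Fml S) (Gl F Gr : List (Atom S))
    (diff : Atom S) (d : Fml S) (R : List (Atom S)) (X Y V W : Set (Vr S)),
    C ∈ Pi ∧ Variant C ⟨H, c, Gl ++ F ++ Gr⟩ ∧
    D ∈ Defsi ∧ Variant D ⟨some diff, d, F ++ R⟩ ∧
    Total Q F X Y ∧ Functional Q F X Y ∧
    Total Q R V W ∧ Functional Q R V W ∧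
    Disjoint W (Clause.vars ⟨H, c, Gl ++ F ++ Gr⟩) ∧
    c.Entails d ∧
    (∀ H', H = some H' → ℓ diff.pred < ℓ H'.pred) ∧
    Pnext = (Pi \ {C}) ∪ {⟨H, c, Gl ++ R ++ [diff] ++ Gr⟩}

/-- The definitions introduced by rule R1 in the steps `0, …, i - 1`. -/
def defsUpTo (rule : ℕ → RuleApp S) (i : ℕ) : Set (Clause S) :=
  {D | ∃ j < i, rule j = .definition D}

/-- `P (i + 1)` is derived from `P i` by the rule application `rule i`. -/
def IsStep (ℓ : S.Pred → ℕ) (P : ℕ → Set (Clause S)) (rule : ℕ → RuleApp S) (i : ℕ) : Prop :=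
  match rule i with
  | .definition D => DefinitionRule ℓ P i D (P (i + 1))
  | .unfolding C A => UnfoldingRule (P 0) (P i) C A (P (i + 1))
  | .folding C D => FoldingRule ℓ (P i) (defsUpTo rule i) C D (P (i + 1))
  | .deletion C => DeletionRule (P i) C (P (i + 1))
  | .functionality C =>
      FunctionalityRule (Definite (P 0) ∪ defsUpTo rule i) (P i) C (P (i + 1))
  | .totality C => TotalityRule (Definite (P 0) ∪ defsUpTo rule i) (P i) C (P (i + 1))
  | .replacement C D =>
      ReplacementRule ℓ (Definite (P 0) ∪ defsUpTo rule i) (P i) (defsUpTo rule i) C D (P (i + 1))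

/-- `P 0 ⇒ P 1 ⇒ … ⇒ P n` is a transformation sequence using the rules R1-R7, where `P i ⇒ P (i + 1)`
by the rule application `rule i`. The initial clauses are constrained Horn clauses, stratified with
respect to the level mapping `ℓ` (which already gives the levels of the predicates introduced by
R1), and in all atoms of the clauses of the sequence every term of basic type is a variable. -/
structure IsTransfSeq (ℓ : S.Pred → ℕ) (n : ℕ) (P : ℕ → Set (Clause S))
    (rule : ℕ → RuleApp S) : Prop where
  constr : ∀ C ∈ P 0, C.constr.IsConstraint
  stratified : ∀ C ∈ P 0, C.Stratified ℓ
  flat : ∀ i ≤ n, ∀ C ∈ P i, C.Flat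
  step : ∀ i < n, IsStep ℓ P rule i

/-- Condition (U): every definition `D` used for folding is unfolded, in some other step, with
respect to an atom of the same level as the head of `D`. -/
def ConditionU (ℓ : S.Pred → ℕ) (n : ℕ) (rule : ℕ → RuleApp S) : Prop :=
  ∀ i, 1 ≤ i → i < n → ∀ C D, rule i = .folding C D →
    ∃ j, 1 ≤ j ∧ j < n ∧ j ≠ i ∧ ∃ D' A H, rule j = .unfolding D' A ∧ Variant D D' ∧
      D.head = some H ∧ ℓ H.pred = ℓ A.pred

end CHC

namespace CHC

variable {S : Signature.{u}}

/-! ### Evaluation and substitution -/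

/-! Functionality passes to smaller least models, so it suffices that no atom of the least model of
`Definite (P 0) ∪ defsUpTo rule i` is lost in `Definite (P n)`. Adding the remaining definitions
only enlarges the first model, so the core is `leastModel_source_subset`. The danger is circularity:
folding can make a predicate call itself, so that a finite derivation from the source yields no
finite derivation from `P n`.

The remedy is a weight. A derivation from the source costs one per clause of `P 0` and nothing per
definition, and only body atoms of the level of the head are followed; `sourceWeight` is the least
cost. Folding does not raise the weight of a body, unfolding an atom of the head's level lowers it
by at least one, and R7 introduces only atoms of strictly lower level, which are not counted. Hence
(`exists_derives`) every true atom whose predicate is already introduced has a deriving instance in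
`P k` whose body weighs no more than the atom, and strictly less if the predicate is initial or its
definition has been unfolded at its own level.

By `layered`, a body atom of the head's level in `P n` has an initial predicate or one used for
folding; Condition (U) makes the latter unfolded. Lexicographic induction on level, weight and a
final bit for "not yet unfolded" then rebuilds a derivation from `P n`.

Two further points. The gain of an unfolding reaches all atoms of the new predicate only if the
unfolded variant of the definition is its sole clause at that moment; `eq_of_size_eq` proves this
from the size of constraints. And unfolding uses syntactic unifiers whereas instances are semantic;
flatness of the atoms reconciles them in `IsMGU.exists_eval_eq`. -/

/-- The valuation obtained by evaluating a substitution. -/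
def Sbst.eval (v : Valuation S) (θ : Sbst S) : Valuation S := fun s k => (θ s k).eval v

theorem Tm.eval_subst (θ : Sbst S) (v : Valuation S) {s : Srt S.Adt} (t : Tm S s) :
    (t.subst θ).eval v = t.eval (θ.eval v) := by
  induction t with
  | var => rfl
  | intLit => rfl
  | plus t t' h h' => simp only [Tm.subst, Tm.eval, h, h']
  | scale z t h => simp only [Tm.subst, Tm.eval, h]
  | boolLit => rfl
  | app c args h => simp only [Tm.subst, Tm.eval, h]

theorem Fml.sat_subst (θ : Sbst S) (v : Valuation S) (f : Fml S) :
    (f.subst θ).Sat v ↔ f.Sat (θ.eval v) := by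
  induction f with
  | tru => rfl
  | fls => rfl
  | le t t' => simp only [Fml.subst, Fml.Sat, Tm.eval_subst]
  | holds t => simp only [Fml.subst, Fml.Sat, Tm.eval_subst]
  | eq s t t' => simp only [Fml.subst, Fml.Sat, Tm.eval_subst]
  | neg f h => simp only [Fml.subst, Fml.Sat, h]
  | conj f g h h' => simp only [Fml.subst, Fml.Sat, h, h']
  | disj f g h h' => simp only [Fml.subst, Fml.Sat, h, h']

theorem Atom.eval_subst (θ : Sbst S) (v : Valuation S) (A : Atom S) :
    (A.subst θ).eval v = A.eval (θ.eval v) := by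
  simp only [Atom.subst, Atom.eval, Tm.eval_subst]

theorem Tm.eval_congr {v w : Valuation S} {s : Srt S.Adt} (t : Tm S s)
    (h : AgreeOn t.vars v w) : t.eval v = t.eval w := by
  induction t with
  | var s k => exact h ⟨s, k⟩ rfl
  | intLit => rfl
  | plus t t' ih ih' =>
    simp only [Tm.eval, ih fun x hx => h x (Or.inl hx), ih' fun x hx => h x (Or.inr hx)]
  | scale z t ih => simp only [Tm.eval, ih h]
  | boolLit => rfl
  | app c args ih =>
    simp only [Tm.eval]
    congr 1
    funext k
    exact ih k fun x hx => h x (Set.mem_iUnion.2 ⟨k, hx⟩)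

theorem Fml.sat_congr {v w : Valuation S} (f : Fml S) (h : AgreeOn f.vars v w) :
    f.Sat v ↔ f.Sat w := by
  induction f with
  | tru => rfl
  | fls => rfl
  | le t t' =>
    simp only [Fml.Sat, t.eval_congr fun x hx => h x (Or.inl hx),
      t'.eval_congr fun x hx => h x (Or.inr hx)]
  | holds t => simp only [Fml.Sat, t.eval_congr h]
  | eq s t t' =>
    simp only [Fml.Sat, t.eval_congr fun x hx => h x (Or.inl hx),
      t'.eval_congr fun x hx => h x (Or.inr hx)]
  | neg f ih => simp only [Fml.Sat, ih h]
  | conj f g ih ih' =>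
    simp only [Fml.Sat, ih fun x hx => h x (Or.inl hx), ih' fun x hx => h x (Or.inr hx)]
  | disj f g ih ih' =>
    simp only [Fml.Sat, ih fun x hx => h x (Or.inl hx), ih' fun x hx => h x (Or.inr hx)]

theorem Atom.eval_congr {v w : Valuation S} (A : Atom S) (h : AgreeOn A.vars v w) :
    A.eval v = A.eval w := by
  simp only [Atom.eval]
  congr 1
  funext k
  exact (A.args k).eval_congr fun x hx => h x (Set.mem_iUnion.2 ⟨k, hx⟩)

/-! ### Values as ground terms -/

/-- The ground term that denotes a value. -/
def Val.toTm : {s : Srt S.Adt} → Val S s → Tm S s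
  | _, .int z => .intLit z
  | _, .bool b => .boolLit b
  | _, .app c args => .app c fun k => (args k).toTm

theorem Val.eval_toTm (v : Valuation S) {s : Srt S.Adt} (x : Val S s) : x.toTm.eval v = x := by
  induction x with
  | int => rfl
  | bool => rfl
  | app c args h => simp only [Val.toTm, Tm.eval, h]

/-- The ground substitution given by a valuation. -/
def Valuation.toSbst (v : Valuation S) : Sbst S := fun s k => (v s k).toTm

/-- Flatness is essential: `1 + 1` and `2` have the same value but are different terms. In a flat
term only variables carry basic values, so the ground instance is determined by the value, and
equality of values becomes syntactic unifiability. -/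
theorem Tm.subst_toSbst (v : Valuation S) {s : Srt S.Adt} (t : Tm S s) (ht : t.Flat) :
    t.subst v.toSbst = (t.eval v).toTm := by
  induction t with
  | var => rfl
  | intLit => rfl
  | plus t t' => exact ht.elim
  | scale z t => exact ht.elim
  | boolLit => rfl
  | app c args h =>
    simp only [Tm.subst, Tm.eval, Val.toTm]
    congr 1
    funext k
    exact h k (ht k)

/-- The atom that denotes a ground atom. -/
def GAtom.toAtom (a : GAtom S) : Atom S := ⟨a.pred, fun k => (a.args k).toTm⟩

theorem Atom.subst_toSbst (v : Valuation S) (A : Atom S) (hA : A.Flat) :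
    A.subst v.toSbst = (A.eval v).toAtom := by
  simp only [Atom.subst, Atom.eval, GAtom.toAtom]
  congr 1
  funext k
  exact (A.args k).subst_toSbst v (hA k)

/-- A valuation that identifies two flat atoms factors through each most general unifier. -/
theorem IsMGU.exists_eval_eq {θ : Sbst S} {A B : Atom S} (hθ : IsMGU θ A B) (hA : A.Flat)
    (hB : B.Flat) (v : Valuation S) (h : A.eval v = B.eval v) :
    ∃ w : Valuation S, θ.eval w = v := by
  obtain ⟨δ, hδ⟩ := hθ.2 v.toSbst (by
    rw [IsUnifier, A.subst_toSbst v hA, B.subst_toSbst v hB, h])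
  -- `δ` may leave variables; how they are valued is irrelevant, because the composite of `θ` and
  -- `δ` is the ground substitution `v.toSbst`.
  refine ⟨δ.eval v, ?_⟩
  funext s k
  have := congrArg (Tm.eval v) (hδ s k)
  rw [Tm.eval_subst] at this
  rw [Sbst.eval, ← this, Valuation.toSbst, Val.eval_toTm]

theorem Tm.Flat.subst_rnm {ρ : Srt S.Adt → ℕ → ℕ} {s : Srt S.Adt} {t : Tm S s} (ht : t.Flat) :
    (t.subst (rnm ρ)).Flat := by
  induction t with
  | var => trivial
  | intLit => exact ht.elim
  | plus t t' => exact ht.elim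
  | scale z t => exact ht.elim
  | boolLit => exact ht.elim
  | app c args h => exact fun k => h k (ht k)

theorem Atom.Flat.subst_rnm {ρ : Srt S.Adt → ℕ → ℕ} {A : Atom S} (hA : A.Flat) :
    (A.subst (rnm ρ)).Flat := fun k => (hA k).subst_rnm

theorem Clause.Flat.variant {C D : Clause S} (hC : C.Flat) (h : Variant C D) : D.Flat := by
  obtain ⟨ρ, hh, -, hb⟩ := h
  constructor
  · intro H hH
    rw [hh] at hH
    obtain ⟨H', hH', rfl⟩ := Option.map_eq_some_iff.1 hH
    exact (hC.1 H' hH').subst_rnm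
  · intro A hA
    obtain ⟨A', hA', rfl⟩ := List.mem_map.1 (hb.mem_iff.1 hA)
    exact (hC.2 A' hA').subst_rnm

/-! ### Size of constraints and head predicates -/

/-- The number of connectives and atomic formulas of a formula. -/
def Fml.size : Fml S → ℕ
  | .neg f => f.size + 1
  | .conj f g => f.size + g.size + 1
  | .disj f g => f.size + g.size + 1
  | _ => 1

theorem Fml.size_subst (θ : Sbst S) (f : Fml S) : (f.subst θ).size = f.size := by
  induction f with
  | neg f h => simp only [Fml.subst, Fml.size, h]
  | conj f g h h' => simp only [Fml.subst, Fml.size, h, h']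
  | disj f g h h' => simp only [Fml.subst, Fml.size, h, h']
  | _ => rfl

/-- The predicate symbol of the head of a clause. -/
def Clause.headPred (C : Clause S) : Option S.Pred := C.head.map Atom.pred

theorem Clause.headPred_eq_some {C : Clause S} {H : Atom S} (h : C.head = some H) :
    C.headPred = some H.pred := by rw [Clause.headPred, h, Option.map_some]

theorem Variant.headPred_eq {C D : Clause S} (h : Variant C D) : D.headPred = C.headPred := by
  obtain ⟨ρ, hh, -, -⟩ := h
  rw [Clause.headPred, hh, Option.map_map]
  rfl

/-- Constraint size is the variant-invariant by which a definition is recognised later in the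
sequence, in `eq_of_size_eq`. -/
theorem Variant.size_eq {C D : Clause S} (h : Variant C D) : D.constr.size = C.constr.size := by
  obtain ⟨ρ, -, hc, -⟩ := h
  rw [hc, Fml.size_subst]

theorem Variant.exists_pred_eq {C D : Clause S} (h : Variant C D) {A : Atom S} (hA : A ∈ D.body) :
    ∃ B ∈ C.body, B.pred = A.pred := by
  obtain ⟨ρ, -, -, hb⟩ := h
  obtain ⟨A', hA', rfl⟩ := List.mem_map.1 (hb.mem_iff.1 hA)
  exact ⟨A', hA', rfl⟩

theorem Clause.HasPred.of_headPred {C : Clause S} {p : S.Pred} (h : C.headPred = some p) :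
    C.HasPred p := by
  obtain ⟨H, hH, rfl⟩ := Option.map_eq_some_iff.1 h
  exact Or.inl ⟨H, hH, rfl⟩

theorem Variant.hasPred {C D : Clause S} (h : Variant C D) {p : S.Pred} (hp : D.HasPred p) :
    C.HasPred p := by
  rcases hp with ⟨H, hH, rfl⟩ | ⟨A, hA, rfl⟩
  · exact .of_headPred (h.headPred_eq ▸ Clause.headPred_eq_some hH)
  · obtain ⟨B, hB, hBA⟩ := h.exists_pred_eq hA
    exact Or.inr ⟨B, hB, hBA⟩

/-! ### Clause instances and weighted derivations -/

/-- The instance of `C` under `v` has head `a`, a true constraint, and its body is true in `M`. -/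
def Clause.Derives (M : Set (GAtom S)) (C : Clause S) (v : Valuation S) (a : GAtom S) : Prop :=
  (∃ H, C.head = some H ∧ H.eval v = a) ∧ C.constr.Sat v ∧ ConjTrue M C.body v

theorem Clause.Derives.headPred_eq {M : Set (GAtom S)} {C : Clause S} {v : Valuation S}
    {a : GAtom S} (h : C.Derives M v a) : C.headPred = some a.pred := by
  obtain ⟨⟨H, hH, rfl⟩, -⟩ := h
  exact Clause.headPred_eq_some hH

/-! ### Weight of a body at a single level -/

open Classical in
/-- The sum of the weights of the instances of the atoms of level `L`. -/
noncomputable def levelSum (ℓ : S.Pred → ℕ) (f : GAtom S → ℕ) (L : ℕ) (v : Valuation S)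
    (F : List (Atom S)) : ℕ :=
  (F.map fun A => if ℓ A.pred = L then f (A.eval v) else 0).sum

section levelSum

variable (ℓ : S.Pred → ℕ) (f : GAtom S → ℕ) (L : ℕ) (v : Valuation S)

theorem levelSum_append (F G : List (Atom S)) :
    levelSum ℓ f L v (F ++ G) = levelSum ℓ f L v F + levelSum ℓ f L v G := by
  simp [levelSum]

theorem levelSum_singleton (A : Atom S) :
    levelSum ℓ f L v [A] = if ℓ A.pred = L then f (A.eval v) else 0 := by
  simp [levelSum]

theorem levelSum_perm {F G : List (Atom S)} (h : F.Perm G) :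
    levelSum ℓ f L v F = levelSum ℓ f L v G := (h.map _).sum_eq

theorem levelSum_subst (θ : Sbst S) (F : List (Atom S)) :
    levelSum ℓ f L v (F.map (Atom.subst θ)) = levelSum ℓ f L (θ.eval v) F := by
  simp only [levelSum, List.map_map, Function.comp_def, Atom.eval_subst]
  rfl

theorem levelSum_eq_zero {F : List (Atom S)} (h : ∀ A ∈ F, ℓ A.pred ≠ L) :
    levelSum ℓ f L v F = 0 := by
  refine List.sum_eq_zero fun x hx => ?_
  obtain ⟨A, hA, rfl⟩ := List.mem_map.1 hx
  exact if_neg (h A hA)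

theorem levelSum_mono {g : GAtom S → ℕ} {F : List (Atom S)}
    (h : ∀ A ∈ F, f (A.eval v) ≤ g (A.eval v)) : levelSum ℓ f L v F ≤ levelSum ℓ g L v F := by
  refine List.sum_le_sum fun A hA => ?_
  split_ifs
  · exact h A hA
  · rfl

theorem levelSum_congr {w : Valuation S} {F : List (Atom S)}
    (h : ∀ A ∈ F, A.eval v = A.eval w) : levelSum ℓ f L v F = levelSum ℓ f L w F := by
  unfold levelSum
  congr 1
  refine List.map_congr_left fun A hA => ?_
  rw [h A hA]

theorem le_levelSum {A : Atom S} {F : List (Atom S)} (hA : A ∈ F) (hL : ℓ A.pred = L) :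
    f (A.eval v) ≤ levelSum ℓ f L v F := by
  have := List.single_le_sum (l := F.map fun A => if ℓ A.pred = L then f (A.eval v) else 0)
    (fun _ _ => Nat.zero_le _) _ (List.mem_map_of_mem hA)
  rwa [if_pos hL] at this

end levelSum

theorem ConjTrue.append_iff {M : Set (GAtom S)} {F G : List (Atom S)} {v : Valuation S} :
    ConjTrue M (F ++ G) v ↔ ConjTrue M F v ∧ ConjTrue M G v := by
  simp only [ConjTrue, List.mem_append, or_imp, forall_and]

theorem ConjTrue.singleton_iff {M : Set (GAtom S)} {A : Atom S} {v : Valuation S} :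
    ConjTrue M [A] v ↔ A.eval v ∈ M := by
  simp [ConjTrue]

theorem ConjTrue.map_subst_iff {M : Set (GAtom S)} {F : List (Atom S)} {v : Valuation S}
    {θ : Sbst S} : ConjTrue M (F.map (Atom.subst θ)) v ↔ ConjTrue M F (θ.eval v) := by
  simp [ConjTrue, Atom.eval_subst]

theorem ConjTrue.perm_iff {M : Set (GAtom S)} {F G : List (Atom S)} {v : Valuation S}
    (h : F.Perm G) : ConjTrue M F v ↔ ConjTrue M G v := by
  simp only [ConjTrue, h.mem_iff]

theorem Clause.derives_subst {M : Set (GAtom S)} {C : Clause S} {v : Valuation S} {a : GAtom S}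
    {θ : Sbst S} : (C.subst θ).Derives M v a ↔ C.Derives M (θ.eval v) a := by
  simp only [Clause.Derives, Clause.subst, Fml.sat_subst, ConjTrue.map_subst_iff,
    Option.map_eq_some_iff, Atom.eval_subst, exists_exists_and_eq_and]

/-- Renaming amounts to precomposing valuations with a permutation, so variants derive the same
atoms from bodies of the same weight, and the rules may be analysed on any variant. -/
theorem Variant.derives_iff {C D : Clause S} (h : Variant C D) :
    ∃ ρ : Srt S.Adt → Equiv.Perm ℕ, ∀ v : Valuation S,
      (∀ M a, D.Derives M v a ↔ C.Derives M (fun s k => v s (ρ s k)) a) ∧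
      ∀ ℓ f L, levelSum ℓ f L v D.body = levelSum ℓ f L (fun s k => v s (ρ s k)) C.body := by
  obtain ⟨ρ, hh, hc, hb⟩ := h
  refine ⟨ρ, fun v => ⟨fun M a => ?_, fun ℓ f L => ?_⟩⟩
  · have := Clause.derives_subst (M := M) (C := C) (v := v) (a := a) (θ := rnm fun s => ρ s)
    refine Iff.trans ?_ this
    rw [Clause.Derives, hh, hc, ConjTrue.perm_iff hb]
    rfl
  · rw [levelSum_perm ℓ f L v hb, levelSum_subst]
    rfl

theorem Variant.exists_derives {C D : Clause S} (h : Variant C D) {M : Set (GAtom S)}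
    {v : Valuation S} {a : GAtom S} (hv : C.Derives M v a) :
    ∃ w, D.Derives M w a ∧
      ∀ ℓ f L, levelSum ℓ f L w D.body = levelSum ℓ f L v C.body := by
  obtain ⟨ρ, hρ⟩ := h.derives_iff
  refine ⟨fun s k => v s ((ρ s).symm k), ?_⟩
  have := hρ fun s k => v s ((ρ s).symm k)
  simp only [Equiv.symm_apply_apply] at this
  exact ⟨(this.1 M a).2 hv, this.2⟩

theorem Variant.exists_derives_of_variant {C D : Clause S} (h : Variant C D) {M : Set (GAtom S)}
    {v : Valuation S} {a : GAtom S} (hv : D.Derives M v a) :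
    ∃ w, C.Derives M w a ∧
      ∀ ℓ f L, levelSum ℓ f L w C.body = levelSum ℓ f L v D.body := by
  obtain ⟨ρ, hρ⟩ := h.derives_iff
  exact ⟨_, ((hρ v).1 M a).1 hv, fun ℓ f L => ((hρ v).2 ℓ f L).symm⟩

theorem Clause.TrueIn.mem_of_derives {M : Set (GAtom S)} {C : Clause S} (h : C.TrueIn M)
    {v : Valuation S} {a : GAtom S} (hv : C.Derives M v a) : a ∈ M := by
  obtain ⟨⟨H, hH, rfl⟩, hc, hb⟩ := hv
  obtain ⟨H', hH', hm⟩ := h v hc hb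
  rw [hH] at hH'
  cases hH'
  exact hm

theorem mem_leastModel_of_derives {Q : Set (Clause S)} {C : Clause S} (hC : C ∈ Q)
    {v : Valuation S} {a : GAtom S} (hv : C.Derives (leastModel Q) v a) : a ∈ leastModel Q := by
  intro I hI
  obtain ⟨hH, hc, hb⟩ := hv
  exact (hI C hC).mem_of_derives ⟨hH, hc, fun A hA => hb A hA I hI⟩

theorem leastModel_mono {P Q : Set (Clause S)} (h : P ⊆ Q) : leastModel P ⊆ leastModel Q :=
  fun _ ha I hI => ha I fun C hC => hI C (h hC)

/-! ### Derivation weights that ignore lower levels -/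

/-- `WDeriv ℓ β Q a m`: the ground atom `a` has a derivation from `Q` of weight `m`, where a clause
instance with head predicate `p` weighs `β p` and only the derivations of the body atoms of the
level of the head are counted. -/
inductive WDeriv (ℓ : S.Pred → ℕ) (β : S.Pred → ℕ) (Q : Set (Clause S)) : GAtom S → ℕ → Prop
  | step (C : Clause S) (hC : C ∈ Q) (H : Atom S) (hH : C.head = some H) (v : Valuation S)
      (hc : C.constr.Sat v) (f : GAtom S → ℕ)
      (hb : ∀ A ∈ C.body, WDeriv ℓ β Q (A.eval v) (f (A.eval v))) :
      WDeriv ℓ β Q (H.eval v) (β H.pred + levelSum ℓ f (ℓ H.pred) v C.body)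

/-- The least weight of a derivation. -/
noncomputable def weight (ℓ : S.Pred → ℕ) (β : S.Pred → ℕ) (Q : Set (Clause S)) (a : GAtom S) : ℕ :=
  sInf {m | WDeriv ℓ β Q a m}

section weight

variable {ℓ β : S.Pred → ℕ} {Q : Set (Clause S)}

theorem WDeriv.mem_leastModel {a : GAtom S} {m : ℕ} (h : WDeriv ℓ β Q a m) :
    a ∈ leastModel Q := by
  induction h with
  | step C hC H hH v hc f _ ih => exact mem_leastModel_of_derives hC ⟨⟨H, hH, rfl⟩, hc, ih⟩

theorem exists_wDeriv (hQ : ∀ C ∈ Q, ∃ H, C.head = some H) {a : GAtom S} (ha : a ∈ leastModel Q) :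
    ∃ m, WDeriv ℓ β Q a m := by
  -- The derivable atoms form a model, so they contain the least one.
  refine ha {a | ∃ m, WDeriv ℓ β Q a m} fun C hC v hc hb => ?_
  obtain ⟨H, hH⟩ := hQ C hC
  have : ∀ b, ∃ m, (∃ m, WDeriv ℓ β Q b m) → WDeriv ℓ β Q b m := fun b => by
    by_cases hb : ∃ m, WDeriv ℓ β Q b m
    · exact hb.imp fun _ h _ => h
    -- Default weight for underivable atoms, which never occur in the bodies considered.
    · exact ⟨0, fun h => (hb h).elim⟩
  choose f hf using this
  exact ⟨H, hH, _, .step C hC H hH v hc f fun A hA => hf _ (hb A hA)⟩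

theorem wDeriv_weight (hQ : ∀ C ∈ Q, ∃ H, C.head = some H) {a : GAtom S} (ha : a ∈ leastModel Q) :
    WDeriv ℓ β Q a (weight ℓ β Q a) := Nat.sInf_mem (exists_wDeriv hQ ha)

theorem weight_le (hQ : ∀ C ∈ Q, ∃ H, C.head = some H) {C : Clause S} (hC : C ∈ Q)
    {v : Valuation S} {a : GAtom S} (hv : C.Derives (leastModel Q) v a) :
    weight ℓ β Q a ≤ β a.pred + levelSum ℓ (weight ℓ β Q) (ℓ a.pred) v C.body := by
  obtain ⟨⟨H, hH, rfl⟩, hc, hb⟩ := hv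
  exact Nat.sInf_le (WDeriv.step C hC H hH v hc _ fun A hA => wDeriv_weight hQ (hb A hA))

/-- The last clause instance of a derivation of least weight: its body atoms weigh at most what that
derivation spends on them. -/
theorem exists_le_weight (hQ : ∀ C ∈ Q, ∃ H, C.head = some H) {a : GAtom S}
    (ha : a ∈ leastModel Q) :
    ∃ C ∈ Q, ∃ v, C.Derives (leastModel Q) v a ∧
      β a.pred + levelSum ℓ (weight ℓ β Q) (ℓ a.pred) v C.body ≤ weight ℓ β Q a := by
  have h := wDeriv_weight (ℓ := ℓ) (β := β) hQ ha
  generalize hm : weight ℓ β Q a = m at h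
  cases h with
  | step C hC H hH v hc f hb =>
    refine ⟨C, hC, v, ⟨⟨H, hH, rfl⟩, hc, fun A hA => (hb A hA).mem_leastModel⟩, ?_⟩
    exact Nat.add_le_add_left (levelSum_mono _ _ _ _ fun A hA => Nat.sInf_le (hb A hA)) _

end weight

/-! ### Replacement of a clause by a set of clauses -/

/-- The levels of the body atoms do not exceed the level of the head, and those of the same level
have predicates that satisfy `good`. -/
def Clause.Layered (ℓ : S.Pred → ℕ) (good : S.Pred → Prop) (C : Clause S) : Prop :=
  ∀ H, C.head = some H → ∀ A ∈ C.body,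
    ℓ A.pred ≤ ℓ H.pred ∧ (ℓ A.pred = ℓ H.pred → good A.pred)

theorem Clause.Layered.variant {ℓ : S.Pred → ℕ} {good : S.Pred → Prop} {C D : Clause S}
    (hC : C.Layered ℓ good) (h : Variant C D) : D.Layered ℓ good := by
  intro H hH A hA
  have h1 := h.headPred_eq
  rw [Clause.headPred_eq_some hH] at h1
  obtain ⟨H', hH', hp⟩ := Option.map_eq_some_iff.1 h1.symm
  obtain ⟨B, hB, hBA⟩ := h.exists_pred_eq hA
  rw [← hBA, ← hp]
  exact hC H' hH' B hB

/-- `Pnext` is obtained from `Pi` by replacing `C` by the clauses of `N`. The constraint does not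
get smaller, and gets larger if `N` has several elements; each instance of `C` that derives an atom
`a` gives an instance of a clause of `N` whose body weighs less by at least `gain`. -/
structure Replaces (ℓ : S.Pred → ℕ) (M : Set (GAtom S)) (w : GAtom S → ℕ) (good : S.Pred → Prop)
    (gain : S.Pred → ℕ) (Pi : Set (Clause S)) (C : Clause S) (N Pnext : Set (Clause S)) :
    Prop where
  mem : C ∈ Pi
  eq : Pnext = (Pi \ {C}) ∪ N
  headPred : ∀ E ∈ N, E.headPred = C.headPred
  size_le : ∀ E ∈ N, C.constr.size ≤ E.constr.size
  unique : N.Subsingleton ∨ ∀ E ∈ N, C.constr.size < E.constr.size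
  layered : C.Layered ℓ good → ∀ E ∈ N, E.Layered ℓ good
  cover : C.Layered ℓ good → ∀ v a, C.Derives M v a → ∃ E ∈ N, ∃ v', E.Derives M v' a ∧
    levelSum ℓ w (ℓ a.pred) v' E.body + gain a.pred ≤ levelSum ℓ w (ℓ a.pred) v C.body

/-! ### Effect of each rule on deriving instances and their weights -/

section rules

variable {ℓ : S.Pred → ℕ} {M : Set (GAtom S)} {w : GAtom S → ℕ} {good : S.Pred → Prop}
  {Pi Pnext : Set (Clause S)} {C D : Clause S}

/-- Replacement of (a variant of) a clause by a single clause with the same head. -/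
theorem Replaces.of_variant {C' E : Clause S} (hC : C ∈ Pi) (hv : Variant C C')
    (hP : Pnext = (Pi \ {C}) ∪ {E}) (hh : E.head = C'.head)
    (hs : C'.constr.size ≤ E.constr.size)
    (hl : C'.Layered ℓ good → E.Layered ℓ good)
    (hc : C'.Layered ℓ good → ∀ v a, C'.Derives M v a → ∃ v', E.Derives M v' a ∧
      levelSum ℓ w (ℓ a.pred) v' E.body ≤ levelSum ℓ w (ℓ a.pred) v C'.body) :
    Replaces ℓ M w good (fun _ => 0) Pi C {E} Pnext where
  mem := hC
  eq := hP
  headPred := by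
    rintro _ rfl
    rw [← hv.headPred_eq, Clause.headPred, hh, Clause.headPred]
  size_le := by
    rintro _ rfl
    exact hv.size_eq ▸ hs
  unique := Or.inl Set.subsingleton_singleton
  layered := by
    rintro h _ rfl
    exact hl (h.variant hv)
  cover := by
    intro h v a ha
    obtain ⟨v₁, h₁, hs₁⟩ := hv.exists_derives ha
    obtain ⟨v₂, h₂, hs₂⟩ := hc (h.variant hv) v₁ a h₁
    exact ⟨E, rfl, v₂, h₂, hs₁ ℓ w (ℓ a.pred) ▸ hs₂⟩

/-- Dropping body atoms keeps every deriving instance and cannot raise the weight of its body. -/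
theorem TotalityRule.replaces {Q : Set (Clause S)} (h : TotalityRule Q Pi C Pnext) :
    ∃ N, Replaces ℓ M w good (fun _ => 0) Pi C N Pnext := by
  obtain ⟨H, c, Gl, F, Gr, X, Y, hC, hv, -, -, hP⟩ := h
  refine ⟨_, .of_variant hC hv hP rfl le_rfl (fun hl H' hH' A hA => hl H' hH' A ?_) ?_⟩
  · simp only [List.mem_append] at hA ⊢
    tauto
  · rintro - v a ⟨hH, hc, hb⟩
    simp only [ConjTrue.append_iff] at hb
    refine ⟨v, ⟨hH, hc, ConjTrue.append_iff.2 ⟨hb.1.1, hb.2⟩⟩, ?_⟩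
    simp only [levelSum_append]
    omega

theorem sat_tupleEq {Y : List (Vr S)} {ζ : Srt S.Adt → ℕ → ℕ} {v : Valuation S}
    (h : AgreeOn {y | y ∈ Y} v fun s k => v s (ζ s k)) : (tupleEq Y ζ).Sat v := by
  unfold tupleEq
  induction Y with
  | nil => trivial
  | cons y Y ih =>
    exact ⟨h y List.mem_cons_self, ih fun x hx => h x (List.mem_cons_of_mem y hx)⟩

/-- Functionality is given for the least model of `Q`, truth for `M`; `hM` bridges the two because
the predicates of `F` occur in `Pi`. -/
theorem FunctionalityRule.replaces {Q : Set (Clause S)} (h : FunctionalityRule Q Pi C Pnext)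
    (hM : ∀ a ∈ M, OccursIn a.pred Pi → a ∈ leastModel Q) :
    ∃ N, Replaces ℓ M w good (fun _ => 0) Pi C N Pnext := by
  obtain ⟨H, c, Gl, F, Gr, X, Y, ζ, hC, hv, -, hζ, -, -, ⟨⟨-, -, hXY⟩, hF⟩, hP⟩ := h
  refine ⟨_, .of_variant hC hv hP rfl ?_ (fun hl H' hH' A hA => hl H' hH' A ?_) ?_⟩
  · simp only [Fml.size]
    omega
  · simp only [List.mem_append] at hA ⊢
    tauto
  · rintro - v a ⟨hH, hc, hb⟩
    have hocc : ∀ A ∈ F, OccursIn A.pred Pi := fun A hA =>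
      ⟨C, hC, hv.hasPred (Or.inr ⟨A, by simp [hA], rfl⟩)⟩
    simp only [ConjTrue.append_iff, ConjTrue.map_subst_iff] at hb
    -- The copy `F(X,Z)` under `v` is `F(X,Y)` under `v` composed with `ζ`. The two valuations agree
    -- on `X`, since `ζ` moves only variables of `Y`, so functionality yields the added equations.
    refine ⟨v, ⟨hH, ⟨hc, sat_tupleEq (hF _ _ ?_ ?_ ?_)⟩,
      ConjTrue.append_iff.2 ⟨ConjTrue.append_iff.2 ⟨hb.1.1, hb.1.2.1⟩, hb.2⟩⟩, ?_⟩
    · intro x hx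
      have : x ∉ Y := fun hxY => Set.disjoint_left.1 hXY hx hxY
      show v x.1 x.2 = v x.1 (ζ x.1 x.2)
      rw [hζ x.1 x.2 this]
    · exact fun A hA => hM _ (hb.1.2.1 A hA) (hocc A hA)
    · exact fun A hA => hM _ (hb.1.2.2 A hA) (hocc A hA)
    · simp only [levelSum_append]
      omega

theorem FoldingRule.mem_defs {Defsi : Set (Clause S)}
    (h : FoldingRule ℓ Pi Defsi C D Pnext) : D ∈ Defsi := by
  obtain ⟨_, _, _, _, _, _, _, _, _, _, _, h, _⟩ := h
  exact h

/-- The folded atom weighs at most the conjunction it replaces when it has the level of the head,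
and is not counted when its level is lower. -/
theorem FoldingRule.replaces {Defsi : Set (Clause S)} (h : FoldingRule ℓ Pi Defsi C D Pnext)
    (hD : ∀ v a, D.Derives M v a → a ∈ M ∧ w a ≤ levelSum ℓ w (ℓ a.pred) v D.body)
    (hgood : ∀ p, D.headPred = some p → good p) :
    ∃ N, Replaces ℓ M w good (fun _ => 0) Pi C N Pnext := by
  obtain ⟨H, c, Gl, Q, Gr, K, d, B, θ, hC, hv, -, hDv, hK, rfl, hcd, hP⟩ := h
  refine ⟨_, .of_variant hC hv hP rfl le_rfl ?_ ?_⟩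
  · intro hl H' hH' A hA
    simp only [List.mem_append, List.mem_singleton] at hA
    rcases hA with (hA | rfl) | hA
    · exact hl H' hH' A (by simp [hA])
    · exact ⟨hK H' hH', fun _ => hgood _ (hDv.headPred_eq ▸ rfl)⟩
    · exact hl H' hH' A (by simp [hA])
  · rintro hl v a ⟨⟨H', hH', rfl⟩, hc, hb⟩
    simp only [ConjTrue.append_iff, ConjTrue.map_subst_iff] at hb
    have hKD : Clause.Derives M ⟨some K, d, B⟩ (θ.eval v) (K.eval (θ.eval v)) :=
      ⟨⟨K, rfl, rfl⟩, (Fml.sat_subst _ _ _).1 (hcd v hc), hb.1.2⟩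
    obtain ⟨v', hv', hs⟩ := hDv.exists_derives_of_variant hKD
    obtain ⟨hmem, hw⟩ := hD _ _ hv'
    rw [hs] at hw
    refine ⟨v, ⟨⟨H', hH', rfl⟩, hc, ?_⟩, ?_⟩
    · simp only [ConjTrue.append_iff, ConjTrue.singleton_iff, Atom.eval_subst]
      exact ⟨⟨hb.1.1, hmem⟩, hb.2⟩
    · simp only [levelSum_append, levelSum_singleton, levelSum_subst, Atom.eval_subst]
      by_cases hL : ℓ K.pred = ℓ H'.pred
      · have : levelSum ℓ w (ℓ K.pred) (θ.eval v) B = levelSum ℓ w (ℓ H'.pred) (θ.eval v) B := by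
          rw [hL]
        rw [if_pos (show ℓ (K.subst θ).pred = ℓ (H'.eval v).pred from hL)]
        change w _ ≤ levelSum ℓ w (ℓ K.pred) (θ.eval v) B at hw
        change _ ≤ _ + levelSum ℓ w (ℓ H'.pred) (θ.eval v) B + _
        omega
      · rw [if_neg (show ¬ ℓ (K.subst θ).pred = ℓ (H'.eval v).pred from hL)]
        omega

theorem ReplacementRule.mem_defs {Q Defsi : Set (Clause S)}
    (h : ReplacementRule ℓ Q Pi Defsi C D Pnext) : D ∈ Defsi := by
  obtain ⟨_, _, _, _, _, _, _, _, _, _, _, _, _, _, h, _⟩ := h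
  exact h

/-- Totality of `R` supplies values for `W`, which makes the body of `diff` true. The new atoms have
level below the head, so their unknown weights do not matter. -/
theorem ReplacementRule.replaces {Q Defsi : Set (Clause S)}
    (h : ReplacementRule ℓ Q Pi Defsi C D Pnext) (hM : leastModel Q ⊆ M)
    (hD : ∀ v a, D.Derives M v a → a ∈ M)
    (hlevel : ∀ p, D.headPred = some p → ∀ A ∈ D.body, ℓ A.pred ≤ ℓ p) :
    ∃ N, Replaces ℓ M w good (fun _ => 0) Pi C N Pnext := by
  obtain ⟨H, c, Gl, F, Gr, K, d, R, X, Y, V, W, hC, hv, -, hDv, -, -, ⟨⟨-, hRV, -⟩, hR⟩, -,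
    hW, hcd, hK, hP⟩ := h
  have hRK : ∀ A ∈ R, ℓ A.pred ≤ ℓ K.pred := fun A hA => by
    obtain ⟨B, hB, hBA⟩ := hDv.exists_pred_eq (A := A) (by simp [hA])
    exact hBA ▸ hlevel _ (hDv.headPred_eq ▸ rfl) B hB
  refine ⟨_, .of_variant hC hv hP rfl le_rfl ?_ ?_⟩
  · intro hl H' hH' A hA
    have hK' := hK H' hH'
    simp only [List.mem_append, List.mem_singleton] at hA
    rcases hA with ((hA | hA) | rfl) | hA
    · exact hl H' hH' A (by simp [hA])
    · have := hRK A hA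
      exact ⟨by omega, fun _ => by omega⟩
    · exact ⟨by omega, fun _ => by omega⟩
    · exact hl H' hH' A (by simp [hA])
  · rintro - v a ⟨⟨H', hH', rfl⟩, hc, hb⟩
    obtain ⟨u, huV, hu⟩ := hR v
    classical
    -- `W` is disjoint from the variables of the clause, so overwriting `v` there leaves head,
    -- constraint and old body unchanged.
    let v' : Valuation S := fun s k => if (⟨s, k⟩ : Vr S) ∈ W then u s k else v s k
    have hv'u : AgreeOn (V ∪ W) v' u := by
      rintro x (hx | hx)
      · show (if _ then _ else _) = _
        split_ifs
        · rfl
        · exact huV x hx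
      · exact if_pos hx
    have hvv' : AgreeOn (Clause.vars ⟨H, c, Gl ++ F ++ Gr⟩) v v' := fun x hx =>
      (if_neg (Set.disjoint_right.1 hW hx)).symm
    have hbody : ∀ A ∈ Gl ++ F ++ Gr, A.eval v = A.eval v' := fun A hA =>
      A.eval_congr fun x hx => hvv' x (Or.inr ⟨A, hA, hx⟩)
    have hb' : ConjTrue M (Gl ++ F ++ Gr) v' := fun A hA => hbody A hA ▸ hb A hA
    have hc' : c.Sat v' := (c.sat_congr fun x hx => hvv' x (Or.inl (Or.inr hx))).1 hc
    have hHv : H'.eval v = H'.eval v' :=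
      H'.eval_congr fun x hx => hvv' x (Or.inl (Or.inl ⟨H', hH', hx⟩))
    have hR' : ConjTrue M R v' := fun A hA => by
      rw [A.eval_congr fun x hx => hv'u x (hRV ▸ ⟨A, hA, hx⟩)]
      exact hM (hu A hA)
    simp only [ConjTrue.append_iff] at hb'
    have hKD : Clause.Derives M ⟨some K, d, F ++ R⟩ v' (K.eval v') :=
      ⟨⟨K, rfl, rfl⟩, hcd v' hc', ConjTrue.append_iff.2 ⟨hb'.1.2, hR'⟩⟩
    obtain ⟨v'', hv'', -⟩ := hDv.exists_derives_of_variant hKD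
    have hKM := hD _ _ hv''
    refine ⟨v', ⟨⟨H', hH', hHv.symm⟩, hc', ?_⟩, ?_⟩
    · simp only [ConjTrue.append_iff, ConjTrue.singleton_iff]
      exact ⟨⟨⟨hb'.1.1, hR'⟩, hKM⟩, hb'.2⟩
    · have hK' := hK H' hH'
      change levelSum ℓ w (ℓ H'.pred) _ _ ≤ levelSum ℓ w (ℓ H'.pred) _ _
      have h₁ : levelSum ℓ w (ℓ H'.pred) v' R = 0 := levelSum_eq_zero _ _ _ _ fun A hA => by
        have := hRK A hA
        omega
      have h₂ : levelSum ℓ w (ℓ H'.pred) v' [K] = 0 := levelSum_eq_zero _ _ _ _ fun A hA => by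
        rw [List.mem_singleton.1 hA]
        omega
      rw [levelSum_congr ℓ w _ v hbody]
      simp only [levelSum_append, h₁, h₂]
      omega

theorem DeletionRule.replaces (h : DeletionRule Pi C Pnext) :
    ∃ N, Replaces ℓ M w good (fun _ => 0) Pi C N Pnext := by
  obtain ⟨hC, hs, hP⟩ := h
  refine ⟨∅, hC, by rw [hP, Set.union_empty], by simp, by simp, Or.inl Set.subsingleton_empty,
    by simp, fun _ v a ha => (hs ⟨v, ha.2.1⟩).elim⟩

theorem UnfoldingRule.mem {P₀ : Set (Clause S)} {A : Atom S}
    (h : UnfoldingRule P₀ Pi C A Pnext) : C ∈ Pi := by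
  obtain ⟨_, _, _, _, _, _, h, _⟩ := h
  exact h

/-- A least-weight derivation of the instance of `A` selects the clause `K` to use. Its cost of one
is saved when `A` has the level of the head; otherwise stratification puts both `A` and the body of
`K` below that level. -/
theorem UnfoldingRule.replaces {P₀ : Set (Clause S)} {A : Atom S}
    (h : UnfoldingRule P₀ Pi C A Pnext)
    (hM : ∀ a ∈ M, OccursIn a.pred P₀ → ∃ K ∈ P₀, ∃ v, K.Derives M v a ∧
      1 + levelSum ℓ w (ℓ a.pred) v K.body ≤ w a)
    (hflat : ∀ K ∈ P₀, K.Flat) (hCflat : C.Flat) (hstrat : ∀ K ∈ P₀, K.Stratified ℓ)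
    (hgood : ∀ p, OccursIn p P₀ → good p) :
    ∃ N, Replaces ℓ M w good (fun p => if ℓ p = ℓ A.pred then 1 else 0) Pi C N Pnext := by
  obtain ⟨H, c, Gl, Gr, apart, θ, hC, hv, hA, hapart, hθ, hP⟩ := h
  have hAflat : A.Flat := (hCflat.variant hv).2 A (by simp)
  have hlt : ∀ K, C.constr.size <
      (unfoldedClause H c Gl Gr (apart K) (θ K)).constr.size := fun K => by
    have := hv.size_eq
    simp only [unfoldedClause, Clause.subst, Fml.size_subst, Fml.size] at this ⊢
    omega
  refine ⟨_, ⟨hC, hP, ?_, ?_, Or.inr ?_, ?_, ?_⟩⟩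
  · rintro _ ⟨K, -, B, -, -, -, rfl⟩
    rw [← hv.headPred_eq, Clause.headPred, unfoldedClause, Clause.subst, Option.map_map]
    rfl
  · rintro _ ⟨K, -, B, -, -, -, rfl⟩
    exact (hlt K).le
  · rintro _ ⟨K, -, B, -, -, -, rfl⟩
    exact hlt K
  · rintro hl _ ⟨K, hK, B, hB, hmgu, -, rfl⟩ H' hH' A' hA'
    replace hl := hl.variant hv
    obtain ⟨H₁, hH₁, rfl⟩ := Option.map_eq_some_iff.1 hH'
    obtain ⟨A₁, hA₁, rfl⟩ := List.mem_map.1 hA'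
    change ℓ A₁.pred ≤ ℓ H₁.pred ∧ (ℓ A₁.pred = ℓ H₁.pred → good A₁.pred)
    simp only [List.mem_append] at hA₁
    rcases hA₁ with (hA₁ | hA₁) | hA₁
    · exact hl H₁ hH₁ A₁ (by simp [hA₁])
    · have hKl : K.Layered ℓ fun p => OccursIn p P₀ := fun H' hH' A' hA' =>
        ⟨hstrat K hK H' hH' A' hA', fun _ => ⟨K, hK, Or.inr ⟨A', hA', rfl⟩⟩⟩
      have h₁ := (hKl.variant (hapart K hK).1 B hB A₁ hA₁).1
      obtain ⟨A₂, hA₂, h₂⟩ := (hapart K hK).1.exists_pred_eq hA₁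
      have h₃ : (A.subst (θ K)).pred = (B.subst (θ K)).pred := congrArg Atom.pred hmgu.1
      have h₄ := (hl H₁ hH₁ A (by simp)).1
      change A.pred = B.pred at h₃
      rw [← h₃] at h₁
      exact ⟨h₁.trans h₄, fun _ => hgood _ ⟨K, hK, Or.inr ⟨A₂, hA₂, h₂⟩⟩⟩
    · exact hl H₁ hH₁ A₁ (by simp [hA₁])
  · intro hl v₀ a ha₀
    replace hl := hl.variant hv
    obtain ⟨v, ha, hs⟩ := hv.exists_derives ha₀
    rw [← hs]
    obtain ⟨⟨H', hH', rfl⟩, hc, hb⟩ := ha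
    simp only [ConjTrue.append_iff, ConjTrue.singleton_iff] at hb
    obtain ⟨K, hK, u₀, hu₀, hw⟩ := hM _ hb.1.2 hA
    obtain ⟨u, hu, hus⟩ := (hapart K hK).1.exists_derives hu₀
    rw [← hus] at hw
    obtain ⟨⟨B, hB, hBA⟩, hKc, hKb⟩ := hu
    classical
    -- Since `apart K` shares no variable with the clause, the two instances combine into one
    -- valuation, under which `A` and `B` coincide.
    let η : Valuation S := fun s k =>
      if (⟨s, k⟩ : Vr S) ∈ (apart K).vars then u s k else v s k
    have hηu : AgreeOn (apart K).vars η u := fun x hx => if_pos hx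
    have hηv : AgreeOn (Clause.vars ⟨H, c, Gl ++ [A] ++ Gr⟩) η v := fun x hx =>
      if_neg (Set.disjoint_right.1 (hapart K hK).2 hx)
    have hCb : ∀ A' ∈ Gl ++ [A] ++ Gr, A'.eval η = A'.eval v := fun A' hA' =>
      A'.eval_congr fun x hx => hηv x (Or.inr ⟨A', hA', hx⟩)
    have hKb' : ∀ A' ∈ (apart K).body, A'.eval η = A'.eval u := fun A' hA' =>
      A'.eval_congr fun x hx => hηu x (Or.inr ⟨A', hA', hx⟩)
    have hBη : B.eval η = B.eval u :=
      B.eval_congr fun x hx => hηu x (Or.inl (Or.inl ⟨B, hB, hx⟩))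
    have hAB : A.eval η = B.eval η := by rw [hCb A (by simp), hBη, hBA]
    have hBflat : B.Flat := ((hflat K hK).variant (hapart K hK).1).1 B hB
    have hmgu : IsMGU (θ K) A B := hθ K hK B hB
      ⟨η.toSbst, by rw [IsUnifier, A.subst_toSbst η hAflat, B.subst_toSbst η hBflat, hAB]⟩
    obtain ⟨δ, hδ⟩ := hmgu.exists_eval_eq hAflat hBflat η hAB
    have hsat : (Fml.conj c (apart K).constr).Sat η :=
      ⟨(c.sat_congr fun x hx => hηv x (Or.inl (Or.inr hx))).2 hc,
        ((apart K).constr.sat_congr fun x hx => hηu x (Or.inl (Or.inr hx))).2 hKc⟩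
    refine ⟨_, ⟨K, hK, B, hB, hmgu, ⟨δ, ?_⟩, rfl⟩, δ, ?_, ?_⟩
    · rwa [Fml.sat_subst, hδ]
    · rw [unfoldedClause, Clause.derives_subst, hδ]
      refine ⟨⟨H', hH', H'.eval_congr fun x hx => hηv x (Or.inl (Or.inl ⟨H', hH', hx⟩))⟩,
        hsat, ?_⟩
      intro A' hA'
      simp only [List.mem_append] at hA'
      rcases hA' with (hA' | hA') | hA'
      · rw [hCb A' (by simp [hA'])]
        exact hb.1.1 A' hA'
      · rw [hKb' A' hA']
        exact hKb A' hA'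
      · rw [hCb A' (by simp [hA'])]
        exact hb.2 A' hA'
    · change levelSum ℓ w (ℓ H'.pred) δ _ + (if ℓ H'.pred = ℓ A.pred then 1 else 0) ≤
        levelSum ℓ w (ℓ H'.pred) v _
      change 1 + levelSum ℓ w (ℓ A.pred) u _ ≤ _ at hw
      rw [unfoldedClause, Clause.subst, levelSum_subst, hδ]
      simp only [levelSum_append, levelSum_singleton]
      rw [levelSum_congr ℓ w _ η (w := v) (F := Gl) fun A' hA' => hCb A' (by simp [hA']),
        levelSum_congr ℓ w _ η (w := v) (F := Gr) fun A' hA' => hCb A' (by simp [hA']),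
        levelSum_congr ℓ w _ η hKb']
      by_cases hL : ℓ A.pred = ℓ H'.pred
      · rw [if_pos hL, if_pos hL.symm, ← hL]
        omega
      · have h₀ : levelSum ℓ w (ℓ H'.pred) u (apart K).body = 0 :=
          levelSum_eq_zero _ _ _ _ fun A' hA' => by
            have hKl : K.Layered ℓ fun _ => True := fun H' hH' A' hA' =>
              ⟨hstrat K hK H' hH' A' hA', fun _ => trivial⟩
            have h₁ := (hKl.variant (hapart K hK).1 B hB A' hA').1
            have h₂ : B.pred = A.pred := congrArg GAtom.pred hBA
            have h₃ := (hl H' hH' A (by simp)).1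
            rw [h₂] at h₁
            omega
        rw [if_neg hL, if_neg (Ne.symm hL), h₀]
        omega

end rules

/-! ### Transformation sequences -/

theorem le_maxLevel (ℓ : S.Pred → ℕ) {F : List (Atom S)} {A : Atom S} (hA : A ∈ F) :
    ℓ A.pred ≤ maxLevel ℓ F := by
  unfold maxLevel
  induction F with
  | nil => cases hA
  | cons B F ih =>
    rcases List.mem_cons.1 hA with rfl | hA
    · exact le_max_left _ _
    · exact (ih hA).trans (le_max_right _ _)

theorem OccursIn.of_headPred {P : Set (Clause S)} {C : Clause S} (hC : C ∈ P) {p : S.Pred}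
    (h : C.headPred = some p) : OccursIn p P := ⟨C, hC, .of_headPred h⟩

theorem defsUpTo_mono {rule : ℕ → RuleApp S} {i j : ℕ} (h : i ≤ j) :
    defsUpTo rule i ⊆ defsUpTo rule j := fun _ ⟨t, ht, hD⟩ => ⟨t, ht.trans_le h, hD⟩

/-! ### The source program and its weight along the sequence -/

/-- The definite clauses of `P 0` and the definitions introduced before step `i`. -/
def source (P : ℕ → Set (Clause S)) (rule : ℕ → RuleApp S) (i : ℕ) : Set (Clause S) :=
  Definite (P 0) ∪ defsUpTo rule i

open Classical in
/-- The weight in which the clauses of `P 0`, but not the definitions, are counted. -/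
noncomputable def sourceWeight (ℓ : S.Pred → ℕ) (P : ℕ → Set (Clause S)) (rule : ℕ → RuleApp S)
    (n : ℕ) : GAtom S → ℕ :=
  weight ℓ (fun p => if OccursIn p (P 0) then 1 else 0) (source P rule n)

/-- The predicate is initial, or the predicate of a definition that is used for folding. -/
def InitialOrFolded (P : ℕ → Set (Clause S)) (rule : ℕ → RuleApp S) (n : ℕ) (p : S.Pred) : Prop :=
  OccursIn p (P 0) ∨ ∃ i < n, ∃ C D, rule i = .folding C D ∧ D.headPred = some p

/-- The predicate is initial, or its definition is unfolded before step `k` with respect to an atom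
of the level of the head. -/
def InitialOrUnfolded (ℓ : S.Pred → ℕ) (P : ℕ → Set (Clause S)) (rule : ℕ → RuleApp S) (n k : ℕ)
    (p : S.Pred) : Prop :=
  OccursIn p (P 0) ∨ ∃ j < k, ∃ D' A, rule j = .unfolding D' A ∧
    ∃ D ∈ defsUpTo rule n, Variant D D' ∧ D.headPred = some p ∧ ℓ p = ℓ A.pred

namespace IsTransfSeq

variable {ℓ : S.Pred → ℕ} {n : ℕ} {P : ℕ → Set (Clause S)} {rule : ℕ → RuleApp S}

theorem definitionRule (hseq : IsTransfSeq ℓ n P rule) {t : ℕ} (ht : t < n) {D : Clause S}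
    (hD : rule t = .definition D) : DefinitionRule ℓ P t D (P (t + 1)) := by
  have := hseq.step t ht
  rwa [IsStep, hD] at this

theorem succ_eq_of_definition (hseq : IsTransfSeq ℓ n P rule) {t : ℕ} (ht : t < n) {D : Clause S}
    (hD : rule t = .definition D) : P (t + 1) = P t ∪ {D} := by
  obtain ⟨_, _, _, _, _, _, _, _, h⟩ := hseq.definitionRule ht hD
  exact h

theorem exists_head_of_definition (hseq : IsTransfSeq ℓ n P rule) {t : ℕ} (ht : t < n)
    {D : Clause S} (hD : rule t = .definition D) : ∃ H, D.head = some H := by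
  obtain ⟨_, _, h, _⟩ := hseq.definitionRule ht hD
  exact ⟨_, h⟩

theorem not_occursIn_of_definition (hseq : IsTransfSeq ℓ n P rule) {t : ℕ} (ht : t < n)
    {D : Clause S} (hD : rule t = .definition D) {p : S.Pred} (hp : D.headPred = some p) :
    ∀ j ≤ t, ¬ OccursIn p (P j) := by
  obtain ⟨newp, _, h, hnew, _⟩ := hseq.definitionRule ht hD
  rw [Clause.headPred_eq_some h, Option.some_inj] at hp
  exact hp ▸ hnew

theorem occursIn_of_mem_body_definition (hseq : IsTransfSeq ℓ n P rule) {t : ℕ} (ht : t < n)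
    {D : Clause S} (hD : rule t = .definition D) {A : Atom S} (hA : A ∈ D.body) :
    OccursIn A.pred (P 0) := by
  obtain ⟨_, _, _, _, _, h, _⟩ := hseq.definitionRule ht hD
  exact h A hA

theorem level_le_of_definition (hseq : IsTransfSeq ℓ n P rule) {t : ℕ} (ht : t < n)
    {D : Clause S} (hD : rule t = .definition D) {p : S.Pred} (hp : D.headPred = some p)
    {A : Atom S} (hA : A ∈ D.body) : ℓ A.pred ≤ ℓ p := by
  obtain ⟨newp, _, h, _, _, _, _, hl, _⟩ := hseq.definitionRule ht hD
  rw [Clause.headPred_eq_some h, Option.some_inj] at hp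
  rw [← hp]
  exact hl ▸ le_maxLevel ℓ hA

theorem exists_head_of_mem_source (hseq : IsTransfSeq ℓ n P rule) :
    ∀ C ∈ source P rule n, ∃ H, C.head = some H := by
  rintro C (hC | ⟨t, ht, hC⟩)
  · exact hC.2
  · exact hseq.exists_head_of_definition ht hC

/-- The least model of the source does not change, later, on the predicates that occur already. -/
theorem mem_leastModel_source (hseq : IsTransfSeq ℓ n P rule) {k : ℕ} {a : GAtom S}
    (ha : a ∈ leastModel (source P rule n)) (hocc : OccursIn a.pred (P k)) :
    a ∈ leastModel (source P rule k) := by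
  -- Making every atom of a not yet introduced predicate true gives a model of the whole source:
  -- clauses already present have bodies over initial predicates, and later definitions have new
  -- heads.
  have := ha (leastModel (source P rule k) ∪ {a | ∀ j ≤ k, ¬ OccursIn a.pred (P j)}) ?_
  · exact this.resolve_right fun h => h k le_rfl hocc
  have key : ∀ C ∈ source P rule k, (∃ H, C.head = some H) →
      (∀ A ∈ C.body, OccursIn A.pred (P 0)) →
      C.TrueIn (leastModel (source P rule k) ∪ {a | ∀ j ≤ k, ¬ OccursIn a.pred (P j)}) := by
    rintro C hC ⟨H, hH⟩ hocc v hc hb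
    exact ⟨H, hH, Or.inl (mem_leastModel_of_derives hC ⟨⟨H, hH, rfl⟩, hc, fun A hA =>
      (hb A hA).resolve_right fun h => h 0 (Nat.zero_le k) (hocc A hA)⟩)⟩
  rintro C (hC | ⟨t, ht, hC⟩)
  · exact key C (Or.inl hC) hC.2 fun A hA => ⟨C, hC.1, Or.inr ⟨A, hA, rfl⟩⟩
  · have hH := hseq.exists_head_of_definition ht hC
    by_cases htk : t < k
    · exact key C (Or.inr ⟨t, htk, hC⟩) hH fun A => hseq.occursIn_of_mem_body_definition ht hC
    · obtain ⟨H, hH⟩ := hH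
      exact fun v _ _ => ⟨H, hH, Or.inr fun j hj =>
        hseq.not_occursIn_of_definition ht hC (Clause.headPred_eq_some hH) j (by omega)⟩

/-- Definitions cost nothing because their heads are not initial; this is why folding does not
increase weight. -/
theorem sourceWeight_le_of_definition (hseq : IsTransfSeq ℓ n P rule) {t : ℕ} (ht : t < n)
    {D : Clause S} (hD : rule t = .definition D) {v : Valuation S} {a : GAtom S}
    (hv : D.Derives (leastModel (source P rule n)) v a) :
    a ∈ leastModel (source P rule n) ∧ sourceWeight ℓ P rule n a ≤
      levelSum ℓ (sourceWeight ℓ P rule n) (ℓ a.pred) v D.body := by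
  have hQ : D ∈ source P rule n := Or.inr ⟨t, ht, hD⟩
  refine ⟨mem_leastModel_of_derives hQ hv, (weight_le hseq.exists_head_of_mem_source hQ hv).trans ?_⟩
  rw [if_neg (hseq.not_occursIn_of_definition ht hD hv.headPred_eq 0 (Nat.zero_le t)), zero_add]
  rfl

open Classical in
theorem exists_le_sourceWeight (hseq : IsTransfSeq ℓ n P rule) {a : GAtom S}
    (ha : a ∈ leastModel (source P rule n)) :
    ∃ C ∈ source P rule n, ∃ v, C.Derives (leastModel (source P rule n)) v a ∧
      (if OccursIn a.pred (P 0) then 1 else 0) +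
        levelSum ℓ (sourceWeight ℓ P rule n) (ℓ a.pred) v C.body ≤ sourceWeight ℓ P rule n a :=
  exists_le_weight (ℓ := ℓ) (β := fun p => if OccursIn p (P 0) then 1 else 0)
    hseq.exists_head_of_mem_source ha

theorem exists_initial_derives (hseq : IsTransfSeq ℓ n P rule) {a : GAtom S}
    (ha : a ∈ leastModel (source P rule n)) (hocc : OccursIn a.pred (P 0)) :
    ∃ K ∈ P 0, ∃ v, K.Derives (leastModel (source P rule n)) v a ∧
      1 + levelSum ℓ (sourceWeight ℓ P rule n) (ℓ a.pred) v K.body ≤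
        sourceWeight ℓ P rule n a := by
  obtain ⟨C, hC, v, hv, hw⟩ := hseq.exists_le_sourceWeight ha
  rw [if_pos hocc] at hw
  rcases hC with hC | ⟨t, ht, hC⟩
  · exact ⟨C, hC.1, v, hv, hw⟩
  · exact (hseq.not_occursIn_of_definition ht hC hv.headPred_eq 0 (Nat.zero_le t) hocc).elim

/-- A step other than a definition step replaces a clause, with a gain if it unfolds an atom of the
level of the head. -/
theorem exists_replaces (hseq : IsTransfSeq ℓ n P rule) {k : ℕ} (hk : k < n)
    (hdef : ∀ D, rule k ≠ .definition D) :
    ∃ C N gain, Replaces ℓ (leastModel (source P rule n)) (sourceWeight ℓ P rule n)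
      (InitialOrFolded P rule n) gain (P k) C N (P (k + 1)) ∧
      ∀ C' A, rule k = .unfolding C' A →
        C' = C ∧ gain = fun p => if ℓ p = ℓ A.pred then 1 else 0 := by
  have h := hseq.step k hk
  unfold IsStep at h
  split at h <;> rename_i hr
  · exact (hdef _ hr).elim
  · obtain ⟨N, hN⟩ := h.replaces (fun a ha hocc => hseq.exists_initial_derives ha hocc)
      (hseq.flat 0 (Nat.zero_le n)) (hseq.flat k hk.le _ h.mem) hseq.stratified fun p hp => Or.inl hp
    refine ⟨_, N, _, hN, fun C' A h => ?_⟩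
    rw [hr] at h
    cases h
    exact ⟨rfl, rfl⟩
  · obtain ⟨t, ht, hD⟩ := h.mem_defs
    obtain ⟨N, hN⟩ := h.replaces (good := InitialOrFolded P rule n)
      (fun v a => hseq.sourceWeight_le_of_definition (ht.trans hk) hD)
      fun p hp => Or.inr ⟨k, hk, _, _, hr, hp⟩
    exact ⟨_, N, _, hN, fun C' A h => by rw [hr] at h; cases h⟩
  · obtain ⟨N, hN⟩ := h.replaces
    exact ⟨_, N, _, hN, fun C' A h => by rw [hr] at h; cases h⟩
  · obtain ⟨N, hN⟩ := h.replaces fun a ha hocc => hseq.mem_leastModel_source ha hocc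
    exact ⟨_, N, _, hN, fun C' A h => by rw [hr] at h; cases h⟩
  · obtain ⟨N, hN⟩ := h.replaces
    exact ⟨_, N, _, hN, fun C' A h => by rw [hr] at h; cases h⟩
  · obtain ⟨t, ht, hD⟩ := h.mem_defs
    obtain ⟨N, hN⟩ := h.replaces
      (leastModel_mono (Set.union_subset_union_right _ (defsUpTo_mono hk.le)))
      (fun v a hv => (hseq.sourceWeight_le_of_definition (ht.trans hk) hD hv).1)
      fun p hp A hA => hseq.level_le_of_definition (ht.trans hk) hD hp hA
    exact ⟨_, N, _, hN, fun C' A h => by rw [hr] at h; cases h⟩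

/-! ### Tracking clauses and weights from step to step -/

/-- The constraint of a definition never shrinks, and as long as it does not grow, there is only one
clause for the new predicate. -/
theorem eq_of_size_eq (hseq : IsTransfSeq ℓ n P rule) {t : ℕ} {D : Clause S}
    (hD : rule t = .definition D) {p : S.Pred} (hp : D.headPred = some p) {k : ℕ} (htk : t < k)
    (hk : k ≤ n) : ∀ C ∈ P k, C.headPred = some p → D.constr.size ≤ C.constr.size ∧
      (C.constr.size = D.constr.size → ∀ C' ∈ P k, C'.headPred = some p → C' = C) := by
  induction k, htk using Nat.le_induction with
  | base =>
    have hnew := hseq.not_occursIn_of_definition hk hD hp t le_rfl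
    have h : ∀ C ∈ P (t + 1), C.headPred = some p → C = D := by
      intro C hC hCp
      rw [hseq.succ_eq_of_definition hk hD] at hC
      exact hC.resolve_left fun hC => hnew (.of_headPred hC hCp)
    intro C hC hCp
    obtain rfl := h C hC hCp
    exact ⟨le_rfl, fun _ => h⟩
  | succ k htk ih =>
    replace ih := ih (by omega)
    by_cases hdef : ∃ E, rule k = .definition E
    · obtain ⟨E, hE⟩ := hdef
      have h : ∀ C ∈ P (k + 1), C.headPred = some p → C ∈ P k := by
        intro C hC hCp
        rw [hseq.succ_eq_of_definition hk hE] at hC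
        refine hC.resolve_right fun hCE => ?_
        -- A later definition cannot reuse `p`, which occurs from `P (t + 1)` on.
        refine hseq.not_occursIn_of_definition hk hE (hCE ▸ hCp) (t + 1) htk ?_
        rw [hseq.succ_eq_of_definition (by omega) hD]
        exact .of_headPred (Or.inr rfl) hp
      intro C hC hCp
      obtain ⟨h₁, h₂⟩ := ih C (h C hC hCp) hCp
      exact ⟨h₁, fun hs C' hC' hCp' => h₂ hs C' (h C' hC' hCp') hCp'⟩
    · obtain ⟨C₀, N, gain, hR, -⟩ := hseq.exists_replaces hk (by simpa using hdef)
      intro C hC hCp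
      rw [hR.eq] at hC ⊢
      have hN : ∀ E ∈ N, E.headPred = some p → C₀.headPred = some p :=
        fun E hE hEp => hR.headPred E hE ▸ hEp
      rcases hC with hC | hC
      · obtain ⟨h₁, h₂⟩ := ih C hC.1 hCp
        refine ⟨h₁, fun hs C' hC' hCp' => ?_⟩
        rcases hC' with hC' | hC'
        · exact h₂ hs C' hC'.1 hCp'
        · exact (hC.2 (h₂ hs C₀ hR.mem (hN C' hC' hCp')).symm).elim
      · obtain ⟨h₁, h₂⟩ := ih C₀ hR.mem (hN C hC hCp)
        have h₃ := hR.size_le C hC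
        refine ⟨h₁.trans h₃, fun hs C' hC' hCp' => ?_⟩
        rcases hC' with hC' | hC'
        · exact (hC'.2 (h₂ (by omega) C' hC'.1 hCp')).elim
        -- A step that may produce several clauses enlarges the constraint, which the size equality
        -- forbids.
        · rcases hR.unique with hu | hu
          · exact hu hC' hC
          · have := hu C hC
            omega

theorem layered (hseq : IsTransfSeq ℓ n P rule) {k : ℕ} (hk : k ≤ n) :
    ∀ C ∈ P k, C.Layered ℓ (InitialOrFolded P rule n) := by
  induction k with
  | zero =>
    exact fun C hC H hH A hA =>
      ⟨hseq.stratified C hC H hH A hA, fun _ => Or.inl ⟨C, hC, Or.inr ⟨A, hA, rfl⟩⟩⟩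
  | succ k ih =>
    replace ih := ih (by omega)
    by_cases hdef : ∃ E, rule k = .definition E
    · obtain ⟨E, hE⟩ := hdef
      intro C hC
      rw [hseq.succ_eq_of_definition hk hE] at hC
      rcases hC with hC | rfl
      · exact ih C hC
      · exact fun H hH A hA => ⟨hseq.level_le_of_definition hk hE (Clause.headPred_eq_some hH) hA,
          fun _ => Or.inl (hseq.occursIn_of_mem_body_definition hk hE hA)⟩
    · obtain ⟨C₀, N, gain, hR, -⟩ := hseq.exists_replaces hk (by simpa using hdef)
      intro C hC
      rw [hR.eq] at hC
      rcases hC with hC | hC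
      · exact ih C hC.1
      · exact hR.layered (ih C₀ hR.mem) C hC

open Classical in
/-- Each atom of the least model of the source whose predicate is already introduced has a clause
instance in `P k` that does not weigh more, and that weighs less if the predicate is initial or its
definition is unfolded. -/
theorem exists_derives (hseq : IsTransfSeq ℓ n P rule) {k : ℕ} (hk : k ≤ n) {a : GAtom S}
    (ha : a ∈ leastModel (source P rule n))
    (hintro : ∀ t, k ≤ t → t < n → ∀ D, rule t = .definition D → D.headPred ≠ some a.pred) :
    ∃ C ∈ P k, ∃ v, C.Derives (leastModel (source P rule n)) v a ∧
      levelSum ℓ (sourceWeight ℓ P rule n) (ℓ a.pred) v C.body +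
        (if InitialOrUnfolded ℓ P rule n k a.pred then 1 else 0) ≤ sourceWeight ℓ P rule n a := by
  induction k with
  | zero =>
    obtain ⟨C, hC, v, hv, hw⟩ := hseq.exists_le_sourceWeight ha
    rcases hC with hC | ⟨t, ht, hC⟩
    · refine ⟨C, hC.1, v, hv, ?_⟩
      rw [if_pos (.of_headPred hC.1 hv.headPred_eq)] at hw
      have : (if InitialOrUnfolded ℓ P rule n 0 a.pred then 1 else 0) ≤ 1 := by split_ifs <;> simp
      rw [add_comm] at hw
      exact (Nat.add_le_add_left this _).trans hw
    · exact (hintro t (Nat.zero_le t) ht C hC hv.headPred_eq).elim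
  | succ k ih =>
    have hlater : InitialOrUnfolded ℓ P rule n (k + 1) a.pred →
        InitialOrUnfolded ℓ P rule n k a.pred ∨ ∃ D' A, rule k = .unfolding D' A ∧
          ∃ D ∈ defsUpTo rule n, Variant D D' ∧ D.headPred = some a.pred ∧
            ℓ a.pred = ℓ A.pred := by
      rintro (h | ⟨j, hj, h⟩)
      · exact Or.inl (Or.inl h)
      · rcases Nat.lt_succ_iff_lt_or_eq.1 hj with hj | rfl
        · exact Or.inl (Or.inr ⟨j, hj, h⟩)
        · exact Or.inr h
    by_cases hdef : ∃ E, rule k = .definition E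
    · obtain ⟨E, hE⟩ := hdef
      rw [hseq.succ_eq_of_definition hk hE]
      have hnot : ∀ D' A, rule k ≠ .unfolding D' A := by
        intro D' A h
        rw [hE] at h
        cases h
      by_cases hEp : E.headPred = some a.pred
      · have hnew := hseq.not_occursIn_of_definition hk hE hEp
        obtain ⟨C, hC, v, hv, hw⟩ := hseq.exists_le_sourceWeight (ℓ := ℓ) ha
        -- When `E` is introduced it is the only source clause for its predicate: the predicate is
        -- not initial, and it can be introduced only once.
        obtain rfl : C = E := by
          rcases hC with hC | ⟨t, ht, hC⟩
          · exact (hnew 0 (Nat.zero_le k) (.of_headPred hC.1 hv.headPred_eq)).elim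
          · have hoc : ∀ {t}, t < n → ∀ {D}, rule t = .definition D →
                D.headPred = some a.pred → OccursIn a.pred (P (t + 1)) := fun ht D hD hDp => by
              rw [hseq.succ_eq_of_definition ht hD]
              exact .of_headPred (Or.inr rfl) hDp
            rcases lt_trichotomy t k with htk | rfl | htk
            · exact (hnew (t + 1) htk (hoc ht hC hv.headPred_eq)).elim
            · rw [hE] at hC
              cases hC
              rfl
            · exact (hseq.not_occursIn_of_definition ht hC hv.headPred_eq (k + 1) htk
                (hoc hk hE hEp)).elim
        refine ⟨C, Or.inr rfl, v, hv, ?_⟩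
        rw [if_neg (hnew 0 (Nat.zero_le k)), zero_add] at hw
        -- No gain is owed yet: an earlier unfolding of the definition would need its predicate to
        -- occur before its introduction.
        rw [if_neg, add_zero]
        · exact hw
        · rintro (h | ⟨j, hj, D', A, hj', D, -, hDD', hDp, -⟩)
          · exact hnew 0 (Nat.zero_le k) h
          · have hjk : j ≤ k := Nat.le_of_lt_succ hj
            have hstep := hseq.step j (by omega)
            rw [IsStep, hj'] at hstep
            exact hnew j hjk (.of_headPred (UnfoldingRule.mem hstep) (hDD'.headPred_eq ▸ hDp))
      · obtain ⟨C, hC, v, hv, hw⟩ := ih (by omega) fun t hkt ht D hD => by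
          rcases hkt.eq_or_lt with rfl | hkt
          · rw [hE] at hD
            cases hD
            exact hEp
          · exact hintro t hkt ht D hD
        refine ⟨C, Or.inl hC, v, hv, hw.trans' (Nat.add_le_add_left ?_ _)⟩
        split_ifs with h₁ h₂ <;> simp
        rcases hlater h₁ with h | ⟨D', A, h, -⟩
        · exact h₂ h
        · exact hnot D' A h
    · push Not at hdef
      obtain ⟨C₀, N, gain, hR, hgain⟩ := hseq.exists_replaces hk hdef
      obtain ⟨C, hC, v, hv, hw⟩ := ih (by omega) fun t hkt ht D hD => by
        rcases hkt.eq_or_lt with rfl | hkt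
        · exact (hdef D hD).elim
        · exact hintro t hkt ht D hD
      rw [hR.eq]
      have hunf : InitialOrUnfolded ℓ P rule n (k + 1) a.pred →
          InitialOrUnfolded ℓ P rule n k a.pred ∨ (C = C₀ ∧ gain a.pred = 1) := by
        intro h
        refine (hlater h).imp_right ?_
        rintro ⟨D', A, hk', D, ⟨t, ht, hD⟩, hDD', hDp, hl⟩
        obtain ⟨rfl, rfl⟩ := hgain D' A hk'
        have hp' : D'.headPred = some a.pred := hDD'.headPred_eq ▸ hDp
        have htk : t < k := by
          by_contra hkt
          exact hseq.not_occursIn_of_definition ht hD hDp k (not_lt.1 hkt)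
            (.of_headPred hR.mem hp')
        -- The unfolded clause is a variant of `D`, so its constraint has not grown and it is the
        -- only clause for the predicate; hence `C`, which derives `a`, is the clause being
        -- unfolded.
        exact ⟨(hseq.eq_of_size_eq hD hDp htk (by omega) D' hR.mem hp').2 hDD'.size_eq C hC
          hv.headPred_eq, if_pos hl⟩
      by_cases hCC : C = C₀
      · subst hCC
        obtain ⟨E, hE, v', hv', hw'⟩ := hR.cover (hseq.layered (by omega) C hC) v a hv
        refine ⟨E, Or.inr hE, v', hv', ?_⟩
        by_cases h₁ : InitialOrUnfolded ℓ P rule n (k + 1) a.pred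
        · rw [if_pos h₁]
          rcases hunf h₁ with h | ⟨-, h⟩
          · rw [if_pos h] at hw
            omega
          · omega
        · rw [if_neg h₁]
          omega
      · refine ⟨C, Or.inl ⟨hC, hCC⟩, v, hv, hw.trans' (Nat.add_le_add_left ?_ _)⟩
        split_ifs with h₁ h₂ <;> simp
        rcases hunf h₁ with h | h
        · exact h₂ h
        · exact hCC h.1

theorem initialOrUnfolded_of_conditionU (hseq : IsTransfSeq ℓ n P rule)
    (hU : ConditionU ℓ n rule) {p : S.Pred} (h : InitialOrFolded P rule n p) :
    InitialOrUnfolded ℓ P rule n n p := by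
  rcases h with h | ⟨i, hi, C, D, hr, hp⟩
  · exact Or.inl h
  · obtain ⟨t, ht, hD⟩ : D ∈ defsUpTo rule i := by
      have hstep := hseq.step i hi
      rw [IsStep, hr] at hstep
      exact FoldingRule.mem_defs hstep
    obtain ⟨j, -, hj, -, D', A, H, hr', hDD', hH, hl⟩ := hU i (by omega) hi C D hr
    rw [Clause.headPred_eq_some hH, Option.some_inj] at hp
    exact Or.inr ⟨j, hj, D', A, hr', D, ⟨t, ht.trans hi, hD⟩, hDD',
      hp ▸ Clause.headPred_eq_some hH, hp ▸ hl⟩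

/-! ### Rebuilding derivations from the final program -/

/-- The transformations lose no atom of the least model, if Condition (U) is satisfied. -/
theorem leastModel_source_subset (hseq : IsTransfSeq ℓ n P rule) (hU : ConditionU ℓ n rule) :
    leastModel (source P rule n) ⊆ leastModel (Definite (P n)) := by
  classical
  -- Doubling makes room for the bit. From an initial or unfolded head the weight drops strictly;
  -- from any other head it need not, but same-level body atoms are initial or unfolded, so the bit
  -- drops.
  let rank : GAtom S → ℕ ×ₗ ℕ := fun a => toLex (ℓ a.pred, 2 * sourceWeight ℓ P rule n a +
    if InitialOrUnfolded ℓ P rule n n a.pred then 0 else 1)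
  intro a
  induction a using (InvImage.wf rank wellFounded_lt).induction with
  | _ a ih =>
    intro ha
    obtain ⟨C, hC, v, hv, hw⟩ := hseq.exists_derives le_rfl ha fun t h h' => absurd h' h.not_gt
    obtain ⟨⟨H, hH, rfl⟩, hc, hb⟩ := hv
    refine mem_leastModel_of_derives (Q := Definite (P n)) (C := C) ⟨hC, H, hH⟩
      ⟨⟨H, hH, rfl⟩, hc, fun A hA => ih _ ?_ (hb A hA)⟩
    obtain ⟨hl, hg⟩ := hseq.layered le_rfl C hC H hH A hA
    refine Prod.Lex.toLex_lt_toLex.2 ?_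
    rcases hl.lt_or_eq with hlt | heq
    · exact Or.inl hlt
    · refine Or.inr ⟨heq, ?_⟩
      have hA' : InitialOrUnfolded ℓ P rule n n (A.eval v).pred :=
        hseq.initialOrUnfolded_of_conditionU hU (hg heq)
      have := le_levelSum ℓ (sourceWeight ℓ P rule n) (ℓ (H.eval v).pred) v hA heq
      simp only [if_pos hA']
      split_ifs at hw ⊢ <;> omega

end IsTransfSeq

end CHC

/-- Preservation of functionality: in a transformation sequence that satisfies Condition (U), an
atom `A(X,Y)` over a predicate of `Definite(P₀) ∪ Defsᵢ` that is functional from `X` to `Y` with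
respect to `Definite(Pₙ)` is functional from `X` to `Y` with respect to `Definite(P₀) ∪ Defsᵢ`.
The hypothesis `hS` says that every algebraic data type has a ground term. -/
theorem proposition1 {S : CHC.Signature.{u}} (hS : ∀ a : S.Adt, Nonempty (CHC.Val S (.adt a)))
    (ℓ : S.Pred → ℕ) (n : ℕ) (P : ℕ → Set (CHC.Clause S)) (rule : ℕ → CHC.RuleApp S)
    (hseq : CHC.IsTransfSeq ℓ n P rule) (hU : CHC.ConditionU ℓ n rule) :
    ∀ i ≤ n, ∀ (A : CHC.Atom S) (X Y : Set (CHC.Vr S)),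
      CHC.Functional (CHC.Definite (P n)) [A] X Y →
      CHC.OccursIn A.pred (CHC.Definite (P 0) ∪ CHC.defsUpTo rule i) →
      CHC.Functional (CHC.Definite (P 0) ∪ CHC.defsUpTo rule i) [A] X Y := by
  intro i hi A X Y ⟨hXY, hF⟩ _
  -- Functionality has atoms of the model only as premises, so this inclusion transfers it from `P
  -- n`.
  have hsub : CHC.leastModel (CHC.Definite (P 0) ∪ CHC.defsUpTo rule i) ⊆
      CHC.leastModel (CHC.Definite (P n)) :=
    (CHC.leastModel_mono (Set.union_subset_union_right _ (CHC.defsUpTo_mono hi))).trans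
      (hseq.leastModel_source_subset hU)
  exact ⟨hXY, fun v w h hv hw => hF v w h (fun B hB => hsub (hv B hB)) fun B hB => hsub (hw B hB)⟩
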